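/- Let $\Lambda$ be a row-finite $k$-graph without sources, that is, a countable small category with a degree functor $d:\Lambda\to\mathbb N^k$ such that every $\lambda$ with $d(\lambda)=m+n$ factors uniquely as $\lambda=\mu\nu$ with $d(\mu)=m$, $d(\nu)=n$, and such that $v\Lambda^n=\{\lambda: r(\lambda)=v,\ d(\lambda)=n\}$ is finite and non-empty for every object (vertex) $v$ and every $n\in\mathbb N^k$. Vertices are identified with identity morphisms. A $\Lambda$-semibranching function system on a measure space $(X,\mu)$ consists of measurable sets $D_\lambda\subseteq X$, measurable maps $\tau_\lambda:D_\lambda\to X$ with measurable ranges $R_\lambda=\tau_\lambda(D_\lambda)$ ($\lambda\in\Lambda$), and measurable coding maps $\tau^m:X\to X$ ($m\in\mathbb N^k$), such that (a) $0<\mu(D_\lambda)<\infty$ and $\mu(R_\lambda)<\infty$ for all $\lambda$; for each $m$, the sets $R_\lambda$ with $d(\lambda)=m$ have pairwise null intersections and cover $X$ up to a null set; the Radon–Nikodym derivative $\Phi_\lambda=d(\mu\circ\tau_\lambda)/d\mu$ exists and is strictly positive a.e. on $D_\lambda$; and $\tau^{d(\lambda)}\circ\tau_\lambda=\mathrm{id}_{D_\lambda}$;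 (b) $\tau_v=\mathrm{id}_{D_v}$ for every vertex $v$; (c) if $s(\lambda)=r(\nu)$, then $R_\nu\subseteq D_\lambda$ up to a null set and $\tau_\lambda\tau_\nu=\tau_{\lambda\nu}$ a.e. (as partially defined maps, so that $D_{\lambda\nu}=D_\nu$ up to a null set); (d) $\tau^m\circ\tau^n=\tau^{m+n}$ for all $m,n\in\mathbb N^k$. It gives rise to the representation $\pi$ of the Cuntz–Krieger algebra $C^*(\Lambda)$ (the universal $C^*$-algebra generated by a Cuntz–Krieger $\Lambda$-family $\{s_\lambda\}$) on $L^2(X,\mu)$ that is determined by $$(\pi(s_\lambda)f)(x)=\chi_{R_\lambda}(x)\,\Phi_\lambda(\tau^{d(\lambda)}(x))^{-1/2}f(\tau^{d(\lambda)}(x)).$$ Let $\Lambda^\infty$ be the space of infinite paths of $\Lambda$, with the $\sigma$-algebra generated by the cylinder sets $Z(\lambda)=\{x: x(0,d(\lambda))=\lambda\}$. The standard maps on $\Lambda^\infty$ are the prefixing maps $\sigma_\lambda:Z(s(\lambda))\to Z(\lambda)$, $\sigma_\lambda(x)=\lambda x$, and, as coding maps, the shifts $\sigma^m$, $\sigma^m(x)(p,q)=x(p+m,q+m)$.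 **Theorem.** Let $\pi$ be an irreducible representation of $C^*(\Lambda)$ arising from a $\Lambda$-semibranching function system on $(X,\mu)$, where $\mu$ has an atom, i.e. there is a measurable set $A$ with $\mu(A)>0$ such that $\mu(B)=0$ or $\mu(A\setminus B)=0$ for every measurable $B\subseteq A$ (for example, a point of positive finite measure gives rise to one). Then $\pi$ is monic: $\pi(s_\lambda)\neq0$ for all $\lambda\in\Lambda$, and there is a monic vector, i.e. a vector $\xi\in L^2(X,\mu)$ with $$\overline{\operatorname{span}}\{\pi(s_\lambda s_\lambda^*)\xi:\lambda\in\Lambda\}=L^2(X,\mu).$$ Hence $\pi$ is equivalent to a representation on the path space: for every monic vector $\xi$ there is a measure $\nu$ on $\Lambda^\infty$ with $\nu(Z(\lambda))=\langle\xi,\pi(s_\lambda s_\lambda^*)\xi\rangle$ for all $\lambda\in\Lambda$, such that the standard maps $\sigma_\lambda$, $\sigma^m$ form a $\Lambda$-semibranching function system on $(\Lambda^\infty,\nu)$ with domains $D_\lambda=Z(s(\lambda))$, and $\pi$ is unitarily equivalent to the representation of $C^*(\Lambda)$ on $L^2(\Lambda^\infty,\nu)$ that arises from this system. -/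

import Mathlib

open CategoryTheory MeasureTheory
open scoped ENNReal

universe u w

noncomputable section

namespace HigherRank


/-! ### Higher-rank graphs -/

/-- A morphism ("path") of a small category, with its source `s` and range `r`. -/
@[ext]
structure Path (Λ : Type w) [SmallCategory Λ] where
  s : Λ
  r : Λ
  hom : s ⟶ r

/-- The identity morphism at `v`, viewed as a path. -/
def Path.vertex {Λ : Type w} [SmallCategory Λ] (v : Λ) : Path Λ := ⟨v, v, 𝟙 v⟩

/-- A `k`-graph: a countable small category with a degree functor to `ℕ^k` that has the
factorization property. The composite usually written `μν` (first `ν`, then `μ`, so that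
`s(μ) = r(ν)`) is `ν ≫ μ` in Mathlib's notation. -/
structure KGraph (k : ℕ) (Λ : Type w) [SmallCategory Λ] where
  countable : Countable (Path Λ)
  deg : ∀ {v w : Λ}, (v ⟶ w) → (Fin k → ℕ)
  deg_id : ∀ v : Λ, deg (𝟙 v) = 0
  deg_comp : ∀ {a b c : Λ} (g : a ⟶ b) (f : b ⟶ c), deg (g ≫ f) = deg f + deg g
  factorization : ∀ {a c : Λ} (h : a ⟶ c) (m n : Fin k → ℕ), deg h = m + n →
    ∃! p : Σ b : Λ, (a ⟶ b) × (b ⟶ c), p.2.1 ≫ p.2.2 = h ∧ deg p.2.2 = m ∧ deg p.2.1 = n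

variable {k : ℕ} {Λ : Type w} [SmallCategory Λ]

/-- The degree of a path. -/
def KGraph.degree (G : KGraph k Λ) (p : Path Λ) : Fin k → ℕ := G.deg p.hom

/-- The set `vΛⁿ` of paths of degree `n` with range `v`. -/
def KGraph.pathsInto (G : KGraph k Λ) (v : Λ) (n : Fin k → ℕ) : Set (Path Λ) :=
  {p | p.r = v ∧ G.degree p = n}

def KGraph.RowFinite (G : KGraph k Λ) : Prop := ∀ v n, (G.pathsInto v n).Finite

def KGraph.SourceFree (G : KGraph k Λ) : Prop := ∀ v n, (G.pathsInto v n).Nonempty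

/-- An infinite path: a degree-preserving functor `x` from `Ω_k` to `Λ`, spelled out. The
category `Ω_k` has the objects `ℕ^k` and one morphism `(m, n)`, with source `n`, range `m` and
degree `n - m`, for each pair `m ≤ n`, and `x(m, n)` is `map m n`. -/
@[ext]
structure KGraph.InfPath (G : KGraph k Λ) where
  obj : (Fin k → ℕ) → Λ
  map : ∀ m n : Fin k → ℕ, m ≤ n → (obj n ⟶ obj m)
  map_id : ∀ m, map m m le_rfl = 𝟙 (obj m)
  map_comp : ∀ (l m n : Fin k → ℕ) (hlm : l ≤ m) (hmn : m ≤ n),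
    map m n hmn ≫ map l m hlm = map l n (hlm.trans hmn)
  deg_map : ∀ (m n : Fin k → ℕ) (h : m ≤ n), G.deg (map m n h) = n - m

/-- The segment `x(m, n)` of an infinite path. -/
def KGraph.InfPath.segment {G : KGraph k Λ} (x : G.InfPath) (m n : Fin k → ℕ) (h : m ≤ n) :
    Path Λ :=
  ⟨x.obj n, x.obj m, x.map m n h⟩

/-- The shift `σ^m`, given by `σ^m(x)(p, q) = x(p + m, q + m)`. -/
def KGraph.InfPath.shift {G : KGraph k Λ} (m : Fin k → ℕ) (x : G.InfPath) : G.InfPath where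
  obj p := x.obj (p + m)
  map p q h := x.map (p + m) (q + m) (add_le_add_left h m)
  map_id p := x.map_id (p + m)
  map_comp _ _ _ _ _ := x.map_comp _ _ _ _ _
  deg_map p q h := by
    rw [x.deg_map, add_tsub_add_eq_tsub_right]

/-- The cylinder set `Z(p)` of the infinite paths that begin with `p`. -/
def KGraph.cylinder (G : KGraph k Λ) (p : Path Λ) : Set G.InfPath :=
  {x | x.segment 0 (G.degree p) zero_le = p}

/-- The Borel structure of the infinite path space, generated by the (countably many) cylinder
sets, which form a basis of its topology. -/
instance (G : KGraph k Λ) : MeasurableSpace G.InfPath :=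
  MeasurableSpace.generateFrom (Set.range G.cylinder)

/-! ### Cuntz–Krieger families and the `C*`-algebra of a `k`-graph -/

/-- Cuntz–Krieger `Λ`-families in a `C*`-algebra, for a row-finite source-free `k`-graph. -/
structure KGraph.IsCKFamily (G : KGraph k Λ) {A : Type u} [NonUnitalCStarAlgebra A]
    (t : Path Λ → A) : Prop where
  partial_isometry : ∀ p, t p * star (t p) * t p = t p
  vertex_proj : ∀ v, IsStarProjection (t (Path.vertex v))
  vertex_orthogonal : ∀ v v', v ≠ v' → t (Path.vertex v) * t (Path.vertex v') = 0
  mul_eq : ∀ {a b c : Λ} (g : a ⟶ b) (f : b ⟶ c), t ⟨b, c, f⟩ * t ⟨a, b, g⟩ = t ⟨a, c, g ≫ f⟩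
  star_mul_self : ∀ p, star (t p) * t p = t (Path.vertex p.s)
  sum_eq : ∀ v n, t (Path.vertex v) = ∑ᶠ p ∈ G.pathsInto v n, t p * star (t p)

theorem KGraph.IsCKFamily.norm_le_one {G : KGraph k Λ} {A : Type u} [NonUnitalCStarAlgebra A]
    {t : Path Λ → A} (ht : G.IsCKFamily t) (p : Path Λ) : ‖t p‖ ≤ 1 := by
  have key : ∀ q : A, star q * q = q → ‖q‖ ≤ 1 := by
    intro q hq
    have h1 : ‖q‖ * ‖q‖ = ‖q‖ := by
      rw [← CStarRing.norm_star_mul_self, hq]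
    by_contra! h
    nlinarith
  have h2 := key (t (Path.vertex p.s)) (by
    have := ht.vertex_proj p.s
    rw [this.isSelfAdjoint.star_eq, this.isIdempotentElem.eq])
  rw [← ht.star_mul_self p, CStarRing.norm_star_mul_self] at h2
  by_contra! h
  nlinarith

/-- A Cuntz–Krieger family together with the `C*`-algebra (in `Type u`) in which it lives. -/
structure KGraph.CKFamily (G : KGraph k Λ) where
  carrier : Type u
  [cstar : NonUnitalCStarAlgebra carrier]
  fam : Path Λ → carrier
  isCK : G.IsCKFamily fam

instance (G : KGraph k Λ) (F : KGraph.CKFamily.{u} G) : NonUnitalCStarAlgebra F.carrier := F.cstar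

/-- The bounded product of the `C*`-algebras of all Cuntz–Krieger families. -/
abbrev KGraph.CKProduct (G : KGraph k Λ) : Type _ :=
  lp (fun F : KGraph.CKFamily.{u} G => F.carrier) ∞

/-- The element of the bounded product whose coordinate at each family `{t_p}` is `t_p`. -/
def KGraph.preGen (G : KGraph k Λ) (p : Path Λ) : KGraph.CKProduct.{u} G :=
  ⟨fun F => F.fam p, memℓp_infty ⟨1, by rintro _ ⟨F, rfl⟩; exact F.isCK.norm_le_one p⟩⟩

/-- `C*(Λ)`: the universal `C*`-algebra of Cuntz–Krieger `Λ`-families, as the `C*`-algebra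
generated by the universal family `p ↦ (t_p)` in the product over all families `{t_p}`. -/
def KGraph.cstarSubalgebra (G : KGraph k Λ) :
    NonUnitalStarSubalgebra ℂ (KGraph.CKProduct.{u} G) :=
  (NonUnitalStarAlgebra.adjoin ℂ (Set.range (KGraph.preGen.{u} G))).topologicalClosure

abbrev KGraph.CStar (G : KGraph k Λ) : Type _ := KGraph.cstarSubalgebra.{u} G

instance (G : KGraph k Λ) : NonUnitalCStarAlgebra (KGraph.CStar.{u} G) :=
  NonUnitalStarSubalgebra.nonUnitalCStarAlgebra (KGraph.cstarSubalgebra.{u} G)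
    (h_closed := NonUnitalStarSubalgebra.isClosed_topologicalClosure _)

/-- The canonical generator `s_p` of `C*(Λ)`. -/
def KGraph.gen (G : KGraph k Λ) (p : Path Λ) : KGraph.CStar.{u} G :=
  ⟨KGraph.preGen.{u} G p, NonUnitalStarSubalgebra.le_topologicalClosure _
    (NonUnitalStarAlgebra.subset_adjoin ℂ _ ⟨p, rfl⟩)⟩

/-- The canonical generators form a Cuntz–Krieger family. -/
theorem KGraph.isCKFamily_gen (G : KGraph k Λ) (hG : G.RowFinite) :
    G.IsCKFamily (KGraph.gen.{u} G) where
  partial_isometry p := Subtype.ext <| lp.ext <| funext fun F => F.isCK.partial_isometry p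
  vertex_proj v :=
    { isIdempotentElem := Subtype.ext <| lp.ext <| funext fun F =>
        (F.isCK.vertex_proj v).isIdempotentElem
      isSelfAdjoint := Subtype.ext <| lp.ext <| funext fun F =>
        (F.isCK.vertex_proj v).isSelfAdjoint }
  vertex_orthogonal v v' h := Subtype.ext <| lp.ext <| funext fun F =>
    F.isCK.vertex_orthogonal v v' h
  mul_eq g f := Subtype.ext <| lp.ext <| funext fun F => F.isCK.mul_eq g f
  star_mul_self p := Subtype.ext <| lp.ext <| funext fun F => F.isCK.star_mul_self p
  sum_eq v n := by
    refine Subtype.ext <| lp.ext <| funext fun F => ?_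
    have h := F.isCK.sum_eq v n
    rw [finsum_mem_eq_finite_toFinset_sum _ (hG v n)] at h ⊢
    rw [AddSubmonoidClass.coe_finsetSum, lp.coeFn_sum, Finset.sum_apply]
    exact h

/-- The universal property: every Cuntz–Krieger family is the image of the canonical one. -/
theorem KGraph.exists_lift (G : KGraph k Λ) {A : Type u} [NonUnitalCStarAlgebra A]
    {t : Path Λ → A} (ht : G.IsCKFamily t) :
    ∃ π : KGraph.CStar.{u} G →⋆ₙₐ[ℂ] A, ∀ p, π (KGraph.gen.{u} G p) = t p :=
  ⟨{ toFun := fun a => (a : KGraph.CKProduct.{u} G) ⟨A, t, ht⟩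
     map_smul' := fun _ _ => rfl
     map_zero' := rfl
     map_add' := fun _ _ => rfl
     map_mul' := fun _ _ => rfl
     map_star' := fun _ => rfl }, fun _ => rfl⟩

/-! ### Representations -/

/-- A nonzero representation on a Hilbert space without nontrivial closed invariant subspaces. -/
def IsIrreducible {A : Type*} [NonUnitalCStarAlgebra A] {H : Type*} [NormedAddCommGroup H]
    [InnerProductSpace ℂ H] [CompleteSpace H] (π : A →⋆ₙₐ[ℂ] (H →L[ℂ] H)) : Prop :=
  (∃ a, π a ≠ 0) ∧ ∀ K : Submodule ℂ H, IsClosed (K : Set H) →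
    (∀ a, ∀ ξ ∈ K, π a ξ ∈ K) → K = ⊥ ∨ K = ⊤

/-- `ξ` is a monic vector: the linear span of the vectors `t_p t_p^* ξ` is dense. -/
def KGraph.IsMonicVector (G : KGraph k Λ) {H : Type*} [NormedAddCommGroup H]
    [InnerProductSpace ℂ H] [CompleteSpace H] (π : KGraph.CStar.{u} G →⋆ₙₐ[ℂ] (H →L[ℂ] H))
    (ξ : H) : Prop :=
  (Submodule.span ℂ (Set.range fun p : Path Λ =>
    (π (G.gen p) * star (π (G.gen p))) ξ)).topologicalClosure = ⊤

/-- Monic representations: every `t_p = π(s_p)` is nonzero and there is a monic vector. -/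
def KGraph.IsMonic (G : KGraph k Λ) {H : Type*} [NormedAddCommGroup H]
    [InnerProductSpace ℂ H] [CompleteSpace H] (π : KGraph.CStar.{u} G →⋆ₙₐ[ℂ] (H →L[ℂ] H)) :
    Prop :=
  (∀ p : Path Λ, π (G.gen p) ≠ 0) ∧ ∃ ξ : H, G.IsMonicVector π ξ

/-! ### Semibranching function systems -/

/-- `Φ` is (a version of) the Radon–Nikodym derivative `d(μ ∘ σ)/dμ` on `D`, where `μ ∘ σ` is the
set function `E ↦ μ (σ(E))` on the measurable subsets of `D`. -/
def IsRNDeriv {X : Type*} [MeasurableSpace X] (μ : Measure X) (D : Set X) (σ : X → X)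
    (Φ : X → ℝ≥0∞) : Prop :=
  Measurable Φ ∧ ∀ E, MeasurableSet E → E ⊆ D → μ (σ '' E) = ∫⁻ x in E, Φ x ∂μ

/-- Semibranching function systems `{σ_i : D_i → X}`, with Radon–Nikodym derivatives `Φ_i`. Only
the values of `σ_i` on `D_i` matter. -/
structure IsSemibranching {X : Type*} [MeasurableSpace X] (μ : Measure X) {I : Type*}
    (D : I → Set X) (σ : I → X → X) (Φ : I → X → ℝ≥0∞) : Prop where
  countable : Countable I
  measurableSet_dom : ∀ i, MeasurableSet (D i)
  dom_pos : ∀ i, 0 < μ (D i)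
  dom_lt_top : ∀ i, μ (D i) < ∞
  measurable_map : ∀ i, Measurable fun x : D i => σ i x
  measurableSet_range : ∀ i, MeasurableSet (σ i '' D i)
  range_lt_top : ∀ i, μ (σ i '' D i) < ∞
  range_cover : μ (⋃ i, σ i '' D i)ᶜ = 0
  range_disjoint : ∀ i j, i ≠ j → μ (σ i '' D i ∩ σ j '' D j) = 0
  rnDeriv : ∀ i, IsRNDeriv μ (D i) (σ i) (Φ i)
  rnDeriv_pos : ∀ i, ∀ᵐ x ∂μ, x ∈ D i → 0 < Φ i x

/-- `c` is a coding map for the family `{σ_i : D_i → X}`. -/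
def IsCodingMap {X : Type*} [MeasurableSpace X] {I : Type*} (D : I → Set X) (σ : I → X → X)
    (c : X → X) : Prop :=
  Measurable c ∧ ∀ i, ∀ x ∈ D i, c (σ i x) = x

/-- `Λ`-semibranching function systems on `(X, μ)`, with domains `D_p`, prefixing maps
`τ_p : D_p → X` (only their values on `D_p` matter), coding maps `τ^m` and Radon–Nikodym
derivatives `Φ_p`. The almost everywhere equality `τ_p τ_q = τ_{pq}` of partially defined maps
is spelled out as the equality of their domains up to a null set (`dom_comp`) and the equality
of their values (`tau_comp`). -/
structure KGraph.SBFS (G : KGraph k Λ) (X : Type*) [MeasurableSpace X] (μ : Measure X) where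
  dom : Path Λ → Set X
  tau : Path Λ → X → X
  coding : (Fin k → ℕ) → X → X
  Φ : Path Λ → X → ℝ≥0∞
  semibranching : ∀ m : Fin k → ℕ, IsSemibranching μ
    (fun p : {p : Path Λ // G.degree p = m} => dom p) (fun p => tau p) (fun p => Φ p)
  coding_map : ∀ m : Fin k → ℕ, IsCodingMap
    (fun p : {p : Path Λ // G.degree p = m} => dom p) (fun p => tau p) (coding m)
  tau_vertex : ∀ v : Λ, ∀ x ∈ dom (Path.vertex v), tau (Path.vertex v) x = x
  range_subset : ∀ {a b c : Λ} (g : a ⟶ b) (f : b ⟶ c),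
    μ (tau ⟨a, b, g⟩ '' dom ⟨a, b, g⟩ \ dom ⟨b, c, f⟩) = 0
  dom_comp : ∀ {a b c : Λ} (g : a ⟶ b) (f : b ⟶ c),
    dom ⟨a, c, g ≫ f⟩ =ᵐ[μ] dom ⟨a, b, g⟩
  tau_comp : ∀ {a b c : Λ} (g : a ⟶ b) (f : b ⟶ c), ∀ᵐ x ∂μ, x ∈ dom ⟨a, b, g⟩ →
    tau ⟨b, c, f⟩ (tau ⟨a, b, g⟩ x) = tau ⟨a, c, g ≫ f⟩ x
  coding_comp : ∀ m n : Fin k → ℕ, coding m ∘ coding n = coding (m + n)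



/-- The range set `R_p = τ_p(D_p)`. -/
def KGraph.SBFS.range {G : KGraph k Λ} {X : Type*} [MeasurableSpace X] {μ : Measure X}
    (S : G.SBFS X μ) (p : Path Λ) : Set X :=
  S.tau p '' S.dom p

/-- `π` is the representation of `C*(Λ)` on `L²(X, μ)` that arises from the system `S`:
`(π(s_p) ξ)(x) = χ_{R_p}(x) Φ_p(τ^{d(p)}(x))^{-1/2} ξ(τ^{d(p)}(x))` almost everywhere. -/
def KGraph.SBFS.Induces {Y : Type*} [MeasurableSpace Y] {ν : Measure Y} {G : KGraph k Λ}
    (S : G.SBFS Y ν)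
    (π : KGraph.CStar.{u} G →⋆ₙₐ[ℂ] (Lp ℂ 2 ν →L[ℂ] Lp ℂ 2 ν)) : Prop :=
  ∀ (p : Path Λ) (ξ : Lp ℂ 2 ν), π (G.gen p) ξ =ᵐ[ν] (S.range p).indicator fun x =>
    (((S.Φ p (S.coding (G.degree p) x)).toReal ^ (-(1 / 2) : ℝ) : ℝ) : ℂ) *
      ξ (S.coding (G.degree p) x)

/-- `S` is a system on the infinite path space with the standard maps: `D_p = Z(s(p))`, the
prefixing map takes `x ∈ Z(s(p))` to `px`, which is the unique infinite path in `Z(p)` with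
`σ^{d(p)}(px) = x`, and the coding maps are the shifts `σ^m`. -/
def KGraph.SBFS.IsStandard {G : KGraph k Λ} {ν : Measure G.InfPath} (S : G.SBFS G.InfPath ν) :
    Prop :=
  (∀ p, S.dom p = G.cylinder (Path.vertex p.s)) ∧
  (∀ p, ∀ x ∈ G.cylinder (Path.vertex p.s),
    S.tau p x ∈ G.cylinder p ∧ (S.tau p x).shift (G.degree p) = x) ∧
  ∀ m, S.coding m = KGraph.InfPath.shift m

/-- `μ` has an atom: a measurable set of positive measure that is not, up to null sets, the union
of two disjoint sets of positive measure. -/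
def HasAtom {X : Type*} [MeasurableSpace X] (μ : Measure X) : Prop :=
  ∃ A, MeasurableSet A ∧ 0 < μ A ∧ ∀ B ⊆ A, MeasurableSet B → μ B = 0 ∨ μ (A \ B) = 0

/-- A point of positive (finite) measure gives rise to an atom. -/
theorem hasAtom_of_point {X : Type*} [MeasurableSpace X] (μ : Measure X) (y : X)
    (h0 : μ {y} ≠ 0) (h1 : μ {y} ≠ ∞) : HasAtom μ := by
  refine ⟨toMeasurable μ {y}, measurableSet_toMeasurable _ _, ?_, ?_⟩
  · rw [measure_toMeasurable]; exact pos_iff_ne_zero.2 h0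
  · intro B hB hBm
    have hy : y ∈ toMeasurable μ {y} := subset_toMeasurable μ {y} rfl
    have key : ∀ C ⊆ toMeasurable μ {y}, MeasurableSet C → y ∈ C →
        μ (toMeasurable μ {y} \ C) = 0 := by
      intro C hC hCm hyC
      have hle : μ (toMeasurable μ {y}) ≤ μ C := by
        rw [measure_toMeasurable]; exact measure_mono (Set.singleton_subset_iff.2 hyC)
      have hfin : μ C ≠ ∞ :=
        ne_top_of_le_ne_top (by rwa [measure_toMeasurable]) (measure_mono hC)
      rw [measure_sdiff hC hCm.nullMeasurableSet hfin]
      exact tsub_eq_zero_of_le hle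
    by_cases hyB : y ∈ B
    · exact Or.inr (key B hB hBm hyB)
    · left
      have := key (toMeasurable μ {y} \ B) Set.sdiff_subset
        ((measurableSet_toMeasurable _ _).diff hBm) ⟨hy, hyB⟩
      rwa [Set.sdiff_sdiff_cancel_left hB] at this

end HigherRank

end

noncomputable section

namespace HigherRank

variable {k : ℕ} {Λ : Type w} [SmallCategory Λ]

/-! ### Segments of infinite paths -/

/-! Write `t p` for `π (G.gen p)`. To an infinite path `x` belongs its fiber, the space of vectors
fixed by the projections `t p * star (t p)` of all initial segments `p` of `x`. Fibers of different
paths are orthogonal, and `t p` and `star (t p)` move vectors between the fibers of `x` and `px`, so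
the fibers over one orbit (paths that agree after possibly different shifts) span an invariant
subspace.

The atom makes some fiber nonzero. In each degree the range sets cover `X`, and the atom cannot be
split, so it lies in one range set up to a null set. Range projections are multiplications by
indicators of range sets (`proj_apply`), hence the indicator of a finite-measure piece of the atom
is fixed by one projection in each degree, and the corresponding paths fit together to an infinite
path (`exists_mem_fiber`, `support_nonempty`).

By irreducibility the fibers over a single orbit, which is countable, span a dense subspace. Each
nonzero fiber is a line (`fiber_le_span`): the operators `t (x(0,n)) * star (t (x(0,m)))` with `σ^m
x = σ^n x` preserve the fiber of `x`, commute there because addition in `ℕ^k` does, and are closed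
under adjoints. They also act irreducibly, since an invariant subspace of the fiber can be
transported along the orbit to an invariant subspace of `H`. A commuting irreducible family is
scalar, by Schur's lemma.

Unit vectors of the fibers therefore form a countable orthonormal basis that diagonalizes all range
projections, with eigenvalue 1 or 0 according to whether the path lies in the cylinder. Cylinders
shrink to points, so a vector is monic exactly if none of its coordinates vanishes, and such vectors
exist by countability.

For the model on the path space the phases of the basis vectors must be coherent. The induced
operators preserve nonnegative functions, and the fibers are stable under absolute values, so the
basis can be chosen nonnegative; then `t p` carries basis vectors to basis vectors without scalar
factors (`apply_eq_of_isNonneg`). The measure with mass `|⟨e_x, ξ⟩|²` at `x` and the unitary sending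
`e_x` to the normalized point mass at `x` give the equivalence. -/

theorem KGraph.factor_unique (G : KGraph k Λ) {a b c a' b' c' : Λ} {g : a ⟶ b} {f : b ⟶ c}
    {g' : a' ⟶ b'} {f' : b' ⟶ c'} (h : (⟨a, c, g ≫ f⟩ : Path Λ) = ⟨a', c', g' ≫ f'⟩)
    (hf : G.deg f = G.deg f') (hg : G.deg g = G.deg g') :
    (⟨b, c, f⟩ : Path Λ) = ⟨b', c', f'⟩ ∧ (⟨a, b, g⟩ : Path Λ) = ⟨a', b', g'⟩ := by
  rw [Path.mk.injEq] at h
  obtain ⟨rfl, rfl, h⟩ := h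
  have h := eq_of_heq h
  have key := (G.factorization (g ≫ f) _ _ (G.deg_comp g f)).unique
    (y₁ := ⟨b, g, f⟩) (y₂ := ⟨b', g', f'⟩) ⟨rfl, rfl, rfl⟩ ⟨h.symm, hf.symm, hg.symm⟩
  cases key
  exact ⟨rfl, rfl⟩

theorem KGraph.degree_vertex (G : KGraph k Λ) (v : Λ) : G.degree (Path.vertex v) = 0 :=
  G.deg_id v

namespace KGraph.InfPath

variable {G : KGraph k Λ}

theorem degree_segment (x : G.InfPath) {m n : Fin k → ℕ} (h : m ≤ n) :
    G.degree (x.segment m n h) = n - m :=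
  x.deg_map m n h

theorem segment_congr (x : G.InfPath) {m n m' n' : Fin k → ℕ} (h : m ≤ n) (hm : m = m')
    (hn : n = n') : x.segment m n h = x.segment m' n' (hm ▸ hn ▸ h) := by
  subst hm hn; rfl

theorem segment_self (x : G.InfPath) (m : Fin k → ℕ) :
    x.segment m m le_rfl = Path.vertex (x.obj m) := by
  simp [segment, Path.vertex, x.map_id]

theorem segment_shift (x : G.InfPath) {p q : Fin k → ℕ} (m : Fin k → ℕ) (h : p ≤ q) :
    (x.shift m).segment p q h = x.segment (p + m) (q + m) (add_le_add_left h m) :=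
  rfl

theorem segment_factor {x y : G.InfPath} {a b c a' b' c' : Fin k → ℕ} (hab : a ≤ b) (hbc : b ≤ c)
    (hab' : a' ≤ b') (hbc' : b' ≤ c')
    (h : x.segment a c (hab.trans hbc) = y.segment a' c' (hab'.trans hbc'))
    (h1 : b - a = b' - a') (h2 : c - b = c' - b') :
    x.segment a b hab = y.segment a' b' hab' ∧ x.segment b c hbc = y.segment b' c' hbc' := by
  unfold segment at h ⊢
  rw [← x.map_comp a b c hab hbc, ← y.map_comp a' b' c' hab' hbc'] at h
  exact G.factor_unique h (by rw [x.deg_map, y.deg_map, h1]) (by rw [x.deg_map, y.deg_map, h2])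

theorem segment_prefix {x y : G.InfPath} {m n : Fin k → ℕ} (h : m ≤ n)
    (hxy : x.segment 0 n zero_le = y.segment 0 n zero_le) :
    x.segment 0 m zero_le = y.segment 0 m zero_le :=
  (segment_factor zero_le h zero_le h hxy rfl rfl).1

theorem segment_append {x y : G.InfPath} {a b c a' b' c' : Fin k → ℕ} (hab : a ≤ b) (hbc : b ≤ c)
    (hab' : a' ≤ b') (hbc' : b' ≤ c') (h1 : x.segment a b hab = y.segment a' b' hab')
    (h2 : x.segment b c hbc = y.segment b' c' hbc') :
    x.segment a c (hab.trans hbc) = y.segment a' c' (hab'.trans hbc') := by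
  unfold segment at h1 h2 ⊢
  rw [← x.map_comp a b c hab hbc, ← y.map_comp a' b' c' hab' hbc']
  generalize x.map a b hab = f at *
  generalize y.map a' b' hab' = f' at *
  generalize x.map b c hbc = g at *
  generalize y.map b' c' hbc' = g' at *
  generalize x.obj a = xa at *
  generalize x.obj b = xb at *
  generalize x.obj c = xc at *
  generalize y.obj a' = ya at *
  generalize y.obj b' = yb at *
  generalize y.obj c' = yc at *
  cases h1
  cases h2
  rfl

theorem ext_segment {x y : G.InfPath}
    (h : ∀ n, x.segment 0 n zero_le = y.segment 0 n zero_le) : x = y := by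
  have h' : ∀ m n (hmn : m ≤ n), x.segment m n hmn = y.segment m n hmn := fun m n hmn =>
    (segment_factor zero_le hmn zero_le hmn (h n) rfl rfl).2
  obtain ⟨xo, xm, _, _, _⟩ := x
  obtain ⟨yo, ym, _, _, _⟩ := y
  have ho : xo = yo := funext fun n => congrArg Path.s (h n)
  subst ho
  have hm : xm = ym := by
    funext m n hmn
    have := h' m n hmn
    simpa [segment] using this
  subst hm
  rfl

theorem shift_shift (x : G.InfPath) (m n : Fin k → ℕ) :
    (x.shift n).shift m = x.shift (m + n) :=
  ext_segment fun p => by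
    rw [segment_shift, segment_shift, segment_shift]
    exact segment_congr _ _ (add_assoc _ _ _) (add_assoc _ _ _)

theorem shift_zero (x : G.InfPath) : x.shift 0 = x :=
  ext_segment fun p => by
    rw [segment_shift]; exact segment_congr _ _ (add_zero _) (add_zero _)

theorem mem_cylinder_segment (x : G.InfPath) (n : Fin k → ℕ) :
    x ∈ G.cylinder (x.segment 0 n zero_le) :=
  segment_congr _ _ rfl (by rw [degree_segment, tsub_zero])

theorem mem_cylinder_vertex {x : G.InfPath} {v : Λ} :
    x ∈ G.cylinder (Path.vertex v) ↔ x.obj 0 = v := by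
  have h : x.segment 0 (G.degree (Path.vertex v)) zero_le = Path.vertex (x.obj 0) := by
    rw [← segment_self]; exact segment_congr _ _ rfl (G.degree_vertex v)
  change _ = _ ↔ _
  rw [h]
  exact ⟨fun h => congrArg Path.s h, fun h => by rw [h]⟩

theorem range_of_mem_cylinder {x : G.InfPath} {p : Path Λ} (h : x ∈ G.cylinder p) :
    x.obj 0 = p.r :=
  congrArg Path.r h

theorem shift_mem_cylinder {x : G.InfPath} {p : Path Λ} (h : x ∈ G.cylinder p) :
    x.shift (G.degree p) ∈ G.cylinder (Path.vertex p.s) := by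
  rw [mem_cylinder_vertex]
  have := congrArg Path.s (show x.segment 0 (G.degree p) zero_le = p from h)
  rw [← this]
  change x.obj (0 + _) = x.obj _
  rw [zero_add]

/-- An infinite path is determined by an initial segment and the remaining path. -/
theorem eq_of_segment_of_shift {x y : G.InfPath} {m : Fin k → ℕ}
    (h : x.segment 0 m zero_le = y.segment 0 m zero_le) (h' : x.shift m = y.shift m) : x = y := by
  refine ext_segment fun n => segment_prefix (le_add_of_nonneg_right zero_le : n ≤ n + m) ?_
  have hm : m ≤ n + m := le_add_of_nonneg_left zero_le
  refine segment_append zero_le hm zero_le hm h ?_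
  have := congrArg (fun z : G.InfPath => z.segment 0 n zero_le) h'
  simp only [segment_shift] at this
  rw [segment_congr x hm (zero_add m).symm rfl, this]
  exact segment_congr y _ (zero_add m) rfl

theorem eq_of_cylinder_of_shift {x y : G.InfPath} {p : Path Λ} (hx : x ∈ G.cylinder p)
    (hy : y ∈ G.cylinder p) (h : x.shift (G.degree p) = y.shift (G.degree p)) : x = y :=
  eq_of_segment_of_shift (m := G.degree p) (Eq.trans hx (Eq.symm hy)) h

/-- Infinite paths from compatible systems of finite paths. -/
theorem exists_of_compatible (G : KGraph k Λ) (v : Λ) (s : (Fin k → ℕ) → Λ) (h : ∀ n, s n ⟶ v)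
    (hdeg : ∀ n, G.deg (h n) = n) (hcomp : ∀ m n, m ≤ n → ∃ q : s n ⟶ s m, q ≫ h m = h n) :
    ∃ x : G.InfPath, ∀ n, x.segment 0 n zero_le = ⟨s n, v, h n⟩ := by
  choose q hq using hcomp
  have hqd : ∀ m n hmn, G.deg (q m n hmn) = n - m := by
    intro m n hmn
    have := G.deg_comp (q m n hmn) (h m)
    rw [hq, hdeg, hdeg] at this
    exact (tsub_eq_of_eq_add_rev this).symm
  -- Unique factorization makes `h m` cancellable among paths of equal degree; this gives
  -- functoriality of the chosen connecting paths `q`.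
  have cancel : ∀ {a : Λ} {m} (f g : a ⟶ s m), G.deg f = G.deg g → f ≫ h m = g ≫ h m → f = g := by
    intro a m f g hd hfg
    have := (G.factor_unique (congrArg (Path.mk a v) hfg) rfl hd).2
    simpa using this
  -- A path of degree 0 is a vertex: compare its two trivial factorizations, with an identity on
  -- either side.
  have h0 : (⟨s 0, v, h 0⟩ : Path Λ) = Path.vertex v :=
    (G.factor_unique (a := s 0) (g := 𝟙 _) (f := h 0) (g' := h 0) (f' := 𝟙 v) (by simp)
      (by rw [hdeg, G.deg_id]) (by rw [hdeg, G.deg_id])).1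
  let x : G.InfPath :=
    { obj := s
      map := fun m n hmn => q m n hmn
      map_id := fun m => cancel _ _ (by rw [hqd, G.deg_id, tsub_self]) (by rw [hq, Category.id_comp])
      map_comp := fun l m n hlm hmn => cancel _ _
        (by
          rw [G.deg_comp, hqd, hqd, hqd]
          funext i
          have h1 : l i ≤ m i := hlm i
          have h2 : m i ≤ n i := hmn i
          simp only [Pi.add_apply, Pi.sub_apply]
          omega)
        (by rw [Category.assoc, hq, hq, hq])
      deg_map := hqd }
  refine ⟨x, fun n => ?_⟩
  change (⟨s n, s 0, q 0 n _⟩ : Path Λ) = _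
  rw [← hq 0 n zero_le]
  generalize h 0 = h0' at h0
  generalize q 0 n _ = q0
  generalize s 0 = s0 at *
  cases h0
  simp

/-- Every path can be put in front of the infinite paths that begin at its source. -/
theorem exists_prefix (p : Path Λ) (y : G.InfPath) (hy : y ∈ G.cylinder (Path.vertex p.s)) :
    ∃ x ∈ G.cylinder p, x.shift (G.degree p) = y := by
  rw [mem_cylinder_vertex] at hy
  obtain ⟨b, c, f⟩ := p
  dsimp only at hy
  subst hy
  set d := G.degree ⟨y.obj 0, c, f⟩ with hd
  have hfd : G.deg f = d := rfl
  -- Factoring the finite path `p y(0,n)` at degree `n` yields `h`, the future segment of degree `n`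
  -- of `py`; the rest `g` has the degree of `p`.
  have hex : ∀ n, ∃ (b : Λ) (g : y.obj n ⟶ b) (h : b ⟶ c),
      g ≫ h = y.map 0 n zero_le ≫ f ∧ G.deg h = n ∧ G.deg g = d := by
    intro n
    obtain ⟨⟨b, g, h⟩, hp, -⟩ := G.factorization (y.map 0 n zero_le ≫ f) n d
      (by rw [G.deg_comp, y.deg_map, tsub_zero, hfd, add_comm])
    exact ⟨b, g, h, hp⟩
  choose s g h hgh hh hg using hex
  obtain ⟨x, hx⟩ := exists_of_compatible G c s h hh (by
    intro m n hmn
    obtain ⟨⟨b, g', h'⟩, hp, -⟩ := G.factorization (h n) m (n - m)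
      (by rw [hh, add_tsub_cancel_of_le hmn])
    obtain ⟨hp1, hp2, hp3⟩ := hp
    dsimp only at hp1 hp2 hp3
    -- Both sides factor `p y(0,n)` at degree `m`, so the initial piece of `h n` is `h m`.
    have key := (G.factor_unique (g := g n ≫ g') (f := h') (g' := y.map m n hmn ≫ g m) (f' := h m)
      (by
        rw [Category.assoc, Category.assoc, hp1, hgh, hgh, ← Category.assoc, y.map_comp])
      (by rw [hp2, hh]) (by rw [G.deg_comp, G.deg_comp, hp3, hg, hg, y.deg_map, add_comm])).1
    rw [← hp1]
    clear hp1 hp2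
    cases key
    exact ⟨g', rfl⟩)
  have hxn : ∀ n, x.segment 0 (n + d) zero_le = ⟨y.obj n, c, y.map 0 n zero_le ≫ f⟩ := by
    intro n
    have key := (G.factor_unique (g := g (n + d)) (f := h (n + d))
      (g' := y.map n (n + d) (le_add_of_nonneg_right zero_le)) (f' := y.map 0 n zero_le ≫ f)
      (by rw [hgh, ← Category.assoc, y.map_comp])
      (by rw [hh, G.deg_comp, y.deg_map, hfd, tsub_zero, add_comm])
      (by rw [hg, y.deg_map, add_tsub_cancel_left])).1
    rw [hx, key]
  have hdn : ∀ n : Fin k → ℕ, d ≤ n + d := fun n => le_add_of_nonneg_left zero_le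
  have hfac : ∀ n, x.segment 0 d zero_le = ⟨y.obj 0, c, f⟩ ∧
      x.segment d (n + d) (hdn n) = y.segment 0 n zero_le := by
    intro n
    refine G.factor_unique (g := x.map d (n + d) (hdn n)) (f := x.map 0 d zero_le)
      (g' := y.map 0 n zero_le) (f' := f) ?_ ?_ ?_
    · rw [x.map_comp]; exact hxn n
    · rw [x.deg_map, tsub_zero, hfd]
    · rw [x.deg_map, y.deg_map, add_tsub_cancel_right, tsub_zero]
  refine ⟨x, (hfac 0).1, ext_segment fun n => ?_⟩
  rw [segment_shift, ← (hfac n).2]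
  exact segment_congr x _ (zero_add _) rfl

end KGraph.InfPath

/-! ### Prefixing maps on the infinite path space -/

open KGraph.InfPath

/-- The infinite path `px`; the value is junk unless `x` begins at the source of `p`. -/
def KGraph.prepend (G : KGraph k Λ) (p : Path Λ) (x : G.InfPath) : G.InfPath :=
  open Classical in
  if h : x ∈ G.cylinder (Path.vertex p.s) then (exists_prefix p x h).choose else x

theorem KGraph.prepend_mem (G : KGraph k Λ) {p : Path Λ} {x : G.InfPath}
    (h : x ∈ G.cylinder (Path.vertex p.s)) : G.prepend p x ∈ G.cylinder p := by
  rw [prepend, dif_pos h]; exact (exists_prefix p x h).choose_spec.1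

theorem KGraph.shift_prepend (G : KGraph k Λ) {p : Path Λ} {x : G.InfPath}
    (h : x ∈ G.cylinder (Path.vertex p.s)) : (G.prepend p x).shift (G.degree p) = x := by
  rw [prepend, dif_pos h]; exact (exists_prefix p x h).choose_spec.2

theorem KGraph.prepend_shift (G : KGraph k Λ) {p : Path Λ} {x : G.InfPath}
    (h : x ∈ G.cylinder p) : G.prepend p (x.shift (G.degree p)) = x :=
  eq_of_cylinder_of_shift (G.prepend_mem (shift_mem_cylinder h)) h
    (G.shift_prepend (shift_mem_cylinder h))

theorem KGraph.prepend_injOn (G : KGraph k Λ) (p : Path Λ) :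
    Set.InjOn (G.prepend p) (G.cylinder (Path.vertex p.s)) := fun x hx y hy h => by
  rw [← G.shift_prepend hx, ← G.shift_prepend hy, h]

theorem KGraph.prepend_image (G : KGraph k Λ) (p : Path Λ) :
    G.prepend p '' G.cylinder (Path.vertex p.s) = G.cylinder p := by
  ext x
  constructor
  · rintro ⟨y, hy, rfl⟩; exact G.prepend_mem hy
  · intro h; exact ⟨_, shift_mem_cylinder h, G.prepend_shift h⟩

theorem KGraph.prepend_vertex (G : KGraph k Λ) {v : Λ} {x : G.InfPath}
    (h : x ∈ G.cylinder (Path.vertex v)) : G.prepend (Path.vertex v) x = x := by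
  refine eq_of_cylinder_of_shift (p := Path.vertex v) (G.prepend_mem h) h ?_
  rw [G.shift_prepend (p := Path.vertex v) h, G.degree_vertex, shift_zero]

theorem KGraph.mem_cylinder_comp (G : KGraph k Λ) {a b c : Λ} {g : a ⟶ b} {f : b ⟶ c}
    {x : G.InfPath} : x ∈ G.cylinder ⟨a, c, g ≫ f⟩ ↔
      x ∈ G.cylinder ⟨b, c, f⟩ ∧ x.shift (G.deg f) ∈ G.cylinder ⟨a, b, g⟩ := by
  have hle : G.deg f ≤ G.deg f + G.deg g := le_add_of_nonneg_right zero_le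
  have e1 : x ∈ G.cylinder ⟨a, c, g ≫ f⟩ ↔
      x.segment 0 (G.deg f + G.deg g) zero_le = ⟨a, c, g ≫ f⟩ := by
    rw [← segment_congr x (zero_le : 0 ≤ G.deg (g ≫ f)) rfl (G.deg_comp g f)]; rfl
  have e2 : x.shift (G.deg f) ∈ G.cylinder ⟨a, b, g⟩ ↔
      x.segment (G.deg f) (G.deg f + G.deg g) hle = ⟨a, b, g⟩ := by
    rw [← segment_congr x (add_le_add_left (zero_le : 0 ≤ G.deg g) _) (zero_add _) (add_comm _ _)]
    rfl
  rw [e1, e2]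
  change _ ↔ x.segment 0 (G.deg f) zero_le = _ ∧ _
  unfold KGraph.InfPath.segment
  constructor
  · intro h
    rw [← x.map_comp _ _ _ zero_le hle] at h
    exact G.factor_unique h (by rw [x.deg_map, tsub_zero])
      (by rw [x.deg_map, add_tsub_cancel_left])
  · rintro ⟨h1, h2⟩
    rw [← x.map_comp _ _ _ zero_le hle]
    generalize x.map 0 (G.deg f) _ = f' at *
    generalize x.map (G.deg f) _ _ = g' at *
    generalize x.obj 0 = x0 at *
    generalize x.obj (G.deg f) = x1 at *
    generalize x.obj (G.deg f + G.deg g) = x2 at *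
    cases h1
    cases h2
    rfl

theorem KGraph.prepend_comp (G : KGraph k Λ) {a b c : Λ} (g : a ⟶ b) (f : b ⟶ c)
    {x : G.InfPath} (hx : x ∈ G.cylinder (Path.vertex a)) :
    G.prepend ⟨b, c, f⟩ (G.prepend ⟨a, b, g⟩ x) = G.prepend ⟨a, c, g ≫ f⟩ x := by
  have h1 := G.prepend_mem (p := ⟨a, b, g⟩) hx
  have h1' : G.prepend ⟨a, b, g⟩ x ∈ G.cylinder (Path.vertex (⟨b, c, f⟩ : Path Λ).s) :=
    mem_cylinder_vertex.2 (range_of_mem_cylinder h1)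
  have hs : (G.prepend ⟨b, c, f⟩ (G.prepend ⟨a, b, g⟩ x)).shift (G.deg f) =
      G.prepend ⟨a, b, g⟩ x := G.shift_prepend h1'
  refine eq_of_cylinder_of_shift (p := ⟨a, c, g ≫ f⟩)
    (G.mem_cylinder_comp.2 ⟨G.prepend_mem h1', by rwa [hs]⟩) (G.prepend_mem hx) ?_
  rw [G.shift_prepend (p := ⟨a, c, g ≫ f⟩) hx]
  change InfPath.shift (G.deg (g ≫ f)) _ = _
  rw [G.deg_comp, add_comm, ← shift_shift, hs]
  exact G.shift_prepend (p := ⟨a, b, g⟩) hx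

/-! ### Measurability on the infinite path space -/

theorem KGraph.measurableSet_cylinder (G : KGraph k Λ) (p : Path Λ) :
    MeasurableSet (G.cylinder p) :=
  MeasurableSpace.measurableSet_generateFrom ⟨p, rfl⟩

/-- A set of infinite paths is measurable if membership depends on an initial segment only. -/
theorem KGraph.measurableSet_of_segment (G : KGraph k Λ) {B : Set G.InfPath} (n : Fin k → ℕ)
    (h : ∀ x y : G.InfPath, x.segment 0 n zero_le = y.segment 0 n zero_le → x ∈ B → y ∈ B) :
    MeasurableSet B := by
  have : Countable (Path Λ) := G.countable
  have hB : B = ⋃ p ∈ {p | ∃ x ∈ B, x.segment 0 n zero_le = p}, G.cylinder p := by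
    ext y
    simp only [Set.mem_iUnion, Set.mem_ofPred_eq, exists_prop]
    constructor
    · intro hy; exact ⟨_, ⟨y, hy, rfl⟩, mem_cylinder_segment y n⟩
    · rintro ⟨p, ⟨x, hx, rfl⟩, hy⟩
      refine h x y (Eq.symm (Eq.trans ?_ hy)) hx
      exact segment_congr _ _ rfl (by rw [degree_segment, tsub_zero])
  rw [hB]
  exact MeasurableSet.biUnion (Set.to_countable _) fun p _ => G.measurableSet_cylinder p

theorem KGraph.measurable_shift (G : KGraph k Λ) (m : Fin k → ℕ) :
    Measurable (InfPath.shift (G := G) m) := by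
  refine measurable_generateFrom ?_
  rintro _ ⟨p, rfl⟩
  refine G.measurableSet_of_segment (G.degree p + m) fun x y hxy hx => ?_
  have hle : (0 : Fin k → ℕ) + m ≤ G.degree p + m := add_le_add_left zero_le m
  exact Eq.trans (segment_factor zero_le hle zero_le hle hxy rfl rfl).2.symm hx

/-- The segment of `px` up to degree `d(q) + d(p)` depends only on `x` up to degree `d(q)`, so
membership of `px` in `Z(q)` is decided by a finite segment of `x`. -/
theorem KGraph.measurable_prepend (G : KGraph k Λ) (p : Path Λ) :
    Measurable fun x : G.cylinder (Path.vertex p.s) => G.prepend p x := by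
  refine measurable_generateFrom ?_
  rintro _ ⟨q, rfl⟩
  refine ⟨G.cylinder (Path.vertex p.s) ∩ G.prepend p ⁻¹' G.cylinder q, ?_, ?_⟩
  · refine G.measurableSet_of_segment (G.degree q) ?_
    rintro x y hxy ⟨hx, hxq⟩
    have hy : y ∈ G.cylinder (Path.vertex p.s) := by
      rw [mem_cylinder_vertex] at hx ⊢; rw [← hx]; exact (congrArg Path.r hxy).symm
    refine ⟨hy, ?_⟩
    have hd : G.degree p ≤ G.degree q + G.degree p := le_add_of_nonneg_left zero_le
    have key : (G.prepend p x).segment 0 (G.degree q + G.degree p) zero_le =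
        (G.prepend p y).segment 0 (G.degree q + G.degree p) zero_le := by
      refine segment_append zero_le hd zero_le hd
        (Eq.trans (G.prepend_mem hx) (G.prepend_mem hy).symm) ?_
      rw [← G.shift_prepend hx, ← G.shift_prepend hy, segment_shift, segment_shift] at hxy
      rw [segment_congr _ hd (zero_add _).symm rfl, hxy]
      exact segment_congr _ _ (zero_add _) rfl
    exact Eq.trans (segment_prefix (le_add_of_nonneg_right zero_le) key).symm hxq
  · ext x; simp

instance (G : KGraph k Λ) : MeasurableSingletonClass G.InfPath where
  measurableSet_singleton x := by
    have : ({x} : Set G.InfPath) = ⋂ n, G.cylinder (x.segment 0 n zero_le) := by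
      ext y
      simp only [Set.mem_singleton_iff, Set.mem_iInter]
      constructor
      · rintro rfl n; exact mem_cylinder_segment y n
      · intro h
        refine ext_segment fun n => Eq.trans ?_ (h n)
        exact segment_congr _ _ rfl (by rw [degree_segment, tsub_zero])
    rw [this]
    exact MeasurableSet.iInter fun n => G.measurableSet_cylinder _

/-! ### Orbits of the shifts -/

/-- Infinite paths that agree from some position on. -/
def KGraph.orbit (G : KGraph k Λ) (x : G.InfPath) : Set G.InfPath :=
  {y | ∃ m n, y.shift m = x.shift n}

/-- A path `y` with `σ^m y = σ^n x` is recovered from `m`, `n` and its segment `y(0,m)`, and there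
are only countably many such triples. -/
theorem KGraph.orbit_countable (G : KGraph k Λ) (x : G.InfPath) : (G.orbit x).Countable := by
  have : Countable (Path Λ) := G.countable
  have h : ∀ y : G.orbit x, ∃ m n, y.1.shift m = x.shift n := fun y => y.2
  choose m n hmn using h
  refine Set.countable_coe_iff.1 (Function.Injective.countable
    (f := fun y : G.orbit x => (m y, n y, y.1.segment 0 (m y) zero_le)) fun y z hyz => ?_)
  simp only [Prod.mk.injEq] at hyz
  obtain ⟨h1, h2, h3⟩ := hyz
  refine Subtype.ext (eq_of_segment_of_shift (m := m y) ?_ ?_)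
  · rw [h3]; exact segment_congr _ _ rfl h1.symm
  · rw [hmn y, h1, hmn z, h2]

theorem KGraph.mem_orbit_of_shift (G : KGraph k Λ) {x y : G.InfPath} (m : Fin k → ℕ) :
    y.shift m ∈ G.orbit x ↔ y ∈ G.orbit x := by
  constructor
  · rintro ⟨a, b, h⟩; exact ⟨a + m, b, by rw [← shift_shift, h]⟩
  · rintro ⟨a, b, h⟩
    exact ⟨a, m + b, by rw [shift_shift, add_comm, ← shift_shift, h, shift_shift]⟩

/-! ### A form of Schur's lemma -/

/-- A member `T` of the family is normal. If its spectrum is a point, `T` is scalar by functional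
calculus. Two spectral points `a ≠ b` would give nonzero operators `f_a(T)`, `f_b(T)` with product
zero, and the kernel of `f_a(T)` would be a nontrivial invariant subspace. -/
theorem exists_eq_smul_one_of_commute {H : Type*} [NormedAddCommGroup H] [InnerProductSpace ℂ H]
    [CompleteSpace H] (𝓢 : Set (H →L[ℂ] H)) (hcomm : ∀ S ∈ 𝓢, ∀ T ∈ 𝓢, Commute S T)
    (hstar : ∀ S ∈ 𝓢, star S ∈ 𝓢)
    (hirr : ∀ K : Submodule ℂ H, IsClosed (K : Set H) → (∀ T ∈ 𝓢, ∀ ξ ∈ K, T ξ ∈ K) →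
      K = ⊥ ∨ K = ⊤)
    (T : H →L[ℂ] H) (hT : T ∈ 𝓢) : ∃ c : ℂ, T = c • (1 : H →L[ℂ] H) := by
  rcases subsingleton_or_nontrivial H with hH | hH
  · exact ⟨0, ContinuousLinearMap.ext fun ξ => Subsingleton.elim _ _⟩
  have hn : IsStarNormal T := ⟨hcomm _ (hstar _ hT) _ hT⟩
  obtain ⟨a, ha⟩ := spectrum.nonempty T
  by_cases hb : ∀ b ∈ spectrum ℂ T, b = a
  · refine ⟨a, ?_⟩
    have h1 : cfc (id : ℂ → ℂ) T = cfc (fun _ => a) T := cfc_congr fun b hb' => hb b hb'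
    rw [cfc_id ℂ T, cfc_const a T, Algebra.algebraMap_eq_smul_one] at h1
    exact h1
  push Not at hb
  obtain ⟨b, hb, hba⟩ := hb
  exfalso
  -- Tents of radius `|a - b| / 2` around a point `c`: by the triangle inequality those around `a`
  -- and `b` have product zero.
  let f : ℂ → ℂ → ℂ := fun c z => ((max 0 (dist a b / 2 - dist z c) : ℝ) : ℂ)
  have hf : ∀ c, Continuous (f c) := fun c => by fun_prop
  have hd : 0 < dist a b := dist_pos.2 (Ne.symm hba)
  have hne : ∀ c ∈ spectrum ℂ T, cfc (f c) T ≠ 0 := by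
    intro c hc h0
    have := cfc_map_spectrum (f c) T (hf := (hf c).continuousOn)
    rw [h0, spectrum.zero_eq] at this
    have h2 : f c c ∈ ({0} : Set ℂ) := this ▸ ⟨c, hc, rfl⟩
    have h3 : f c c = ((dist a b / 2 : ℝ) : ℂ) := by
      simp only [f, dist_self, sub_zero]; rw [max_eq_right (by positivity)]
    rw [h3, Set.mem_singleton_iff, Complex.ofReal_eq_zero] at h2
    linarith
  have hmul : cfc (f a) T * cfc (f b) T = 0 := by
    rw [← cfc_mul (f a) (f b) T (hf a).continuousOn (hf b).continuousOn, ← cfc_zero ℂ T]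
    refine cfc_congr fun z _ => ?_
    have htri := dist_triangle_left a b z
    simp only [f, Pi.zero_apply]
    rcases le_total (dist a b / 2) (dist z a) with h | h
    · rw [max_eq_left (by linarith)]; simp
    · rw [max_eq_left (a := (0 : ℝ)) (b := dist a b / 2 - dist z b) (by linarith)]; simp
  rcases hirr (cfc (f a) T).ker (cfc (f a) T).isClosed_ker (by
    intro S hS ξ hξ
    -- The family contains `star T`, so `S` commutes with both `T` and its adjoint, as the
    -- functional calculus requires.
    have hc : Commute (cfc (f a) T) S :=
      Commute.cfc (hcomm T hT S hS) (hcomm _ (hstar T hT) S hS) (f a)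
    rw [LinearMap.mem_ker] at hξ ⊢
    have h2 := congrArg (fun A : H →L[ℂ] H => A ξ) hc.eq
    simp only [mul_apply_eq_comp] at h2
    exact h2.trans ((congrArg S hξ).trans (map_zero S))) with h | h
  · apply hne b hb
    refine ContinuousLinearMap.ext fun ξ => ?_
    have : cfc (f b) T ξ ∈ (cfc (f a) T).ker := by
      rw [LinearMap.mem_ker]
      exact congrArg (fun A : H →L[ℂ] H => A ξ) hmul
    rw [h] at this
    simpa using this
  · apply hne a ha
    refine ContinuousLinearMap.ext fun ξ => ?_
    have : ξ ∈ (cfc (f a) T).ker := h ▸ Submodule.mem_top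
    simpa using this

/-! ### The vectors carried by an infinite path -/

section

variable {G : KGraph k Λ} {H : Type*} [NormedAddCommGroup H] [InnerProductSpace ℂ H]
  [CompleteSpace H] {t : Path Λ → (H →L[ℂ] H)}

/-- The vectors that are fixed by the projections `t_p t_p^*` of all initial segments `p` of `x`. -/
def KGraph.fiber (t : Path Λ → (H →L[ℂ] H)) (x : G.InfPath) : Submodule ℂ H where
  carrier := {ξ | ∀ n, t (x.segment 0 n zero_le) (star (t (x.segment 0 n zero_le)) ξ) = ξ}
  zero_mem' n := by simp
  add_mem' hξ hη n := by rw [map_add, map_add, hξ n, hη n]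
  smul_mem' c ξ hξ n := by rw [map_smul, map_smul, hξ n]

theorem KGraph.isClosed_fiber (x : G.InfPath) : IsClosed (G.fiber t x : Set H) := by
  have : (G.fiber t x : Set H) =
      ⋂ n, {ξ | t (x.segment 0 n zero_le) (star (t (x.segment 0 n zero_le)) ξ) = ξ} := by
    ext ξ; simp [fiber]
  rw [this]
  exact isClosed_iInter fun n => isClosed_eq (by fun_prop) continuous_id

/-- Cuntz–Krieger families of operators for which paths of the same degree have orthogonal
ranges. -/
structure KGraph.IsOrthogonalFamily (G : KGraph k Λ) (t : Path Λ → (H →L[ℂ] H)) : Prop where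
  isCK : G.IsCKFamily t
  orthogonal : ∀ p q, G.degree p = G.degree q → p ≠ q → star (t p) * t q = 0

namespace KGraph.IsOrthogonalFamily

variable (ht : G.IsOrthogonalFamily t)
include ht

theorem segment_apply (x : G.InfPath) {l m n : Fin k → ℕ} (hlm : l ≤ m) (hmn : m ≤ n) (ξ : H) :
    t (x.segment l m hlm) (t (x.segment m n hmn) ξ) = t (x.segment l n (hlm.trans hmn)) ξ := by
  have := ht.isCK.mul_eq (x.map m n hmn) (x.map l m hlm)
  rw [x.map_comp] at this
  exact congrArg (fun A : H →L[ℂ] H => A ξ) this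

theorem star_segment_apply (x : G.InfPath) {l m n : Fin k → ℕ} (hlm : l ≤ m) (hmn : m ≤ n)
    (ξ : H) : star (t (x.segment m n hmn)) (star (t (x.segment l m hlm)) ξ) =
      star (t (x.segment l n (hlm.trans hmn))) ξ := by
  have := ht.isCK.mul_eq (x.map m n hmn) (x.map l m hlm)
  rw [x.map_comp] at this
  have := congrArg star this
  rw [star_mul] at this
  exact congrArg (fun A : H →L[ℂ] H => A ξ) this

theorem star_apply_self (p : Path Λ) (ξ : H) :
    star (t p) (t p ξ) = t (Path.vertex p.s) ξ :=
  congrArg (fun A : H →L[ℂ] H => A ξ) (ht.isCK.star_mul_self p)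

theorem apply_vertex (p : Path Λ) (ξ : H) : t p (t (Path.vertex p.s) ξ) = t p ξ := by
  have := ht.isCK.mul_eq (𝟙 p.s) p.hom
  rw [Category.id_comp] at this
  exact congrArg (fun A : H →L[ℂ] H => A ξ) this

theorem vertex_apply (p : Path Λ) (ξ : H) : t (Path.vertex p.r) (t p ξ) = t p ξ := by
  have := ht.isCK.mul_eq p.hom (𝟙 p.r)
  rw [Category.comp_id] at this
  exact congrArg (fun A : H →L[ℂ] H => A ξ) this

theorem star_vertex (v : Λ) : star (t (Path.vertex v)) = t (Path.vertex v) :=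
  (ht.isCK.vertex_proj v).isSelfAdjoint

theorem vertex_vertex (v : Λ) (ξ : H) :
    t (Path.vertex v) (t (Path.vertex v) ξ) = t (Path.vertex v) ξ :=
  congrArg (fun A : H →L[ℂ] H => A ξ) (ht.isCK.vertex_proj v).isIdempotentElem

theorem vertex_star (p : Path Λ) (ξ : H) :
    t (Path.vertex p.s) (star (t p) ξ) = star (t p) ξ := by
  have h : t p * t (Path.vertex p.s) = t p := ContinuousLinearMap.ext (ht.apply_vertex p)
  have := congrArg star h
  rw [star_mul, ht.star_vertex] at this
  exact congrArg (fun A : H →L[ℂ] H => A ξ) this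

theorem vertex_of_mem {x : G.InfPath} {ξ : H} (hξ : ξ ∈ G.fiber t x) :
    t (Path.vertex (x.obj 0)) ξ = ξ := by
  have := hξ 0
  rw [x.segment_self] at this
  rwa [ht.star_vertex, ht.vertex_vertex] at this

/-- With `q = x(n, n+j)`, the vector is `t q` applied to `star (t (x(0,n+j))) ξ`, because `ξ` is
fixed by the projection of the longer segment; so it lies in the range of `t q`. -/
theorem star_segment_mem {x : G.InfPath} {ξ : H} (hξ : ξ ∈ G.fiber t x) (n : Fin k → ℕ) :
    star (t (x.segment 0 n zero_le)) ξ ∈ G.fiber t (x.shift n) := by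
  intro j
  have hle : n ≤ j + n := le_add_of_nonneg_left zero_le
  have e : (x.shift n).segment 0 j zero_le = x.segment n (j + n) hle := by
    rw [InfPath.segment_shift]; exact x.segment_congr _ (zero_add _) rfl
  rw [e]
  conv_rhs => rw [← hξ (j + n), ← ht.segment_apply x zero_le hle, ht.star_apply_self]
  rw [← ht.star_segment_apply x zero_le hle]
  exact (ht.vertex_apply (x.segment n (j + n) hle) _).symm

theorem segment_mem {x : G.InfPath} {m : Fin k → ℕ} {ξ : H} (hξ : ξ ∈ G.fiber t (x.shift m)) :
    t (x.segment 0 m zero_le) ξ ∈ G.fiber t x := by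
  intro j
  have hle : m ≤ j + m := le_add_of_nonneg_left zero_le
  have hle' : j ≤ j + m := le_add_of_nonneg_right zero_le
  have e : (x.shift m).segment 0 j zero_le = x.segment m (j + m) hle := by
    rw [InfPath.segment_shift]; exact x.segment_congr _ (zero_add _) rfl
  have hv : t (Path.vertex (x.obj m)) ξ = ξ := by
    have := ht.vertex_of_mem hξ
    rwa [show (x.shift m).obj 0 = x.obj m from congrArg x.obj (zero_add m)] at this
  -- It suffices to be fixed by the projection of the longer segment `x(0, j+m)`, which is dominated
  -- by that of `x(0,j)` and can be computed by splitting at `m`.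
  have h1 : t (x.segment 0 (j + m) zero_le) (star (t (x.segment 0 (j + m) zero_le))
      (t (x.segment 0 m zero_le) ξ)) = t (x.segment 0 m zero_le) ξ := by
    rw [← ht.segment_apply x zero_le hle, ← ht.star_segment_apply x zero_le hle,
      ht.star_apply_self]
    rw [show t (Path.vertex (x.segment 0 m zero_le).s) ξ = ξ from hv, ← e, hξ j]
  rw [← h1]
  rw [← ht.segment_apply x zero_le hle', ht.star_apply_self]
  congr 1
  exact ht.vertex_apply (x.segment j (j + m) hle') _

theorem star_apply_eq_zero {p q : Path Λ} (hd : G.degree p = G.degree q) (hpq : p ≠ q) (ξ : H) :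
    star (t p) (t q ξ) = 0 :=
  congrArg (fun A : H →L[ℂ] H => A ξ) (ht.orthogonal p q hd hpq)

theorem star_eq_zero_of_notMem {x : G.InfPath} {p : Path Λ} (hx : x ∉ G.cylinder p) {ξ : H}
    (hξ : ξ ∈ G.fiber t x) : star (t p) ξ = 0 := by
  rw [← hξ (G.degree p)]
  exact ht.star_apply_eq_zero (by rw [InfPath.degree_segment, tsub_zero]) (fun h => hx h.symm) _

theorem star_mem {x : G.InfPath} {p : Path Λ} (hx : x ∈ G.cylinder p) {ξ : H}
    (hξ : ξ ∈ G.fiber t x) : star (t p) ξ ∈ G.fiber t (x.shift (G.degree p)) := by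
  have := ht.star_segment_mem hξ (G.degree p)
  rwa [show x.segment 0 (G.degree p) zero_le = p from hx] at this

theorem apply_eq_zero_of_notMem {x : G.InfPath} {p : Path Λ}
    (hx : x ∉ G.cylinder (Path.vertex p.s)) {ξ : H} (hξ : ξ ∈ G.fiber t x) : t p ξ = 0 := by
  rw [← ht.apply_vertex, ← ht.star_vertex, ht.star_eq_zero_of_notMem hx hξ, map_zero]

theorem apply_mem {x : G.InfPath} {p : Path Λ} (hx : x ∈ G.cylinder (Path.vertex p.s)) {ξ : H}
    (hξ : ξ ∈ G.fiber t x) : t p ξ ∈ G.fiber t (G.prepend p x) := by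
  have hp : (G.prepend p x).segment 0 (G.degree p) zero_le = p := G.prepend_mem hx
  have := ht.segment_mem (x := G.prepend p x) (m := G.degree p) (ξ := ξ)
    (by rwa [G.shift_prepend hx])
  rwa [hp] at this

/-- Different infinite paths differ in some segment `x(0,n)`, and paths of the same degree have
orthogonal ranges. -/
theorem inner_eq_zero {x y : G.InfPath} (hxy : x ≠ y) {ξ η : H} (hξ : ξ ∈ G.fiber t x)
    (hη : η ∈ G.fiber t y) : inner ℂ ξ η = 0 := by
  obtain ⟨n, hn⟩ : ∃ n, x.segment 0 n zero_le ≠ y.segment 0 n zero_le := by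
    by_contra! h; exact hxy (InfPath.ext_segment h)
  rw [← hξ n, ← hη n, ← ContinuousLinearMap.adjoint_inner_right,
    ← ContinuousLinearMap.star_eq_adjoint]
  rw [ht.star_apply_eq_zero (by rw [InfPath.degree_segment, InfPath.degree_segment]) hn,
    inner_zero_right]

/-! ### Transport along an orbit -/

/-- Transport from the fiber of `y` to that of `x` removes `y(0,m)` and attaches `x(0,n)`. Going `j`
further on both sides inserts `t q * star (t q)` for an initial segment `q` of the common tail, and
this fixes the vector already obtained over that tail. -/
theorem transport_stable {x y : G.InfPath} {m n : Fin k → ℕ} (h : y.shift m = x.shift n)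
    (j : Fin k → ℕ) {ξ : H} (hξ : ξ ∈ G.fiber t y) :
    t (x.segment 0 (n + j) zero_le) (star (t (y.segment 0 (m + j) zero_le)) ξ) =
      t (x.segment 0 n zero_le) (star (t (y.segment 0 m zero_le)) ξ) := by
  have hm : m ≤ m + j := le_add_of_nonneg_right zero_le
  have hn : n ≤ n + j := le_add_of_nonneg_right zero_le
  rw [← ht.segment_apply x zero_le hn, ← ht.star_segment_apply y zero_le hm]
  have ex : x.segment n (n + j) hn = (x.shift n).segment 0 j zero_le := by
    rw [InfPath.segment_shift]; exact x.segment_congr _ (zero_add _).symm (add_comm _ _)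
  have ey : y.segment m (m + j) hm = (y.shift m).segment 0 j zero_le := by
    rw [InfPath.segment_shift]; exact y.segment_congr _ (zero_add _).symm (add_comm _ _)
  rw [ex, ey, ← h, ht.star_segment_mem hξ m j]

theorem transport_mem {x y : G.InfPath} {m n : Fin k → ℕ} (h : y.shift m = x.shift n)
    {ξ : H} (hξ : ξ ∈ G.fiber t y) :
    t (x.segment 0 n zero_le) (star (t (y.segment 0 m zero_le)) ξ) ∈ G.fiber t x := by
  apply ht.segment_mem
  rw [← h]
  exact ht.star_segment_mem hξ m

/-- The right side is symmetric in the two pairs of shifts, hence transports of a fiber to itself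
commute. To compose, the outer transport is lengthened by `n'` and the inner one by `m`; the two
operators in the middle then belong to the same segment and cancel to a vertex projection. -/
theorem transport_transport {x : G.InfPath} {m n m' n' : Fin k → ℕ} (h : x.shift m = x.shift n)
    (h' : x.shift m' = x.shift n') {ξ : H} (hξ : ξ ∈ G.fiber t x) :
    t (x.segment 0 n zero_le) (star (t (x.segment 0 m zero_le))
      (t (x.segment 0 n' zero_le) (star (t (x.segment 0 m' zero_le)) ξ))) =
    t (x.segment 0 (n + n') zero_le) (star (t (x.segment 0 (m + m') zero_le)) ξ) := by
  rw [← ht.transport_stable h n' (ht.transport_mem h' hξ), ← ht.transport_stable h' m hξ,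
    x.segment_congr (zero_le : 0 ≤ m + n') rfl (add_comm m n'), ht.star_apply_self]
  have : (x.segment 0 (n' + m) zero_le).s = (x.segment 0 (m' + m) zero_le).s := by
    have := congrArg (fun y : G.InfPath => y.obj m) h'
    change x.obj (m + m') = x.obj (m + n') at this
    change x.obj (n' + m) = x.obj (m' + m)
    rw [add_comm n' m, add_comm m' m, this]
  rw [this, ht.vertex_star, x.segment_congr (zero_le : 0 ≤ m' + m) rfl (add_comm m' m)]

end KGraph.IsOrthogonalFamily

/-! ### Irreducibility: the fibers are lines and span -/

/-- No nontrivial closed subspace is invariant under the operators `t_p` and their adjoints. -/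
def IsIrreducibleFamily (t : Path Λ → (H →L[ℂ] H)) : Prop :=
  ∀ K : Submodule ℂ H, IsClosed (K : Set H) →
    (∀ p, ∀ ξ ∈ K, t p ξ ∈ K ∧ star (t p) ξ ∈ K) → K = ⊥ ∨ K = ⊤

/-- An invariant field of subspaces of the fibers spans a dense subspace. -/
theorem KGraph.IsOrthogonalFamily.closure_iSup_eq_top (ht : G.IsOrthogonalFamily t)
    (hirr : IsIrreducibleFamily t) (F : G.InfPath → Submodule ℂ H) (hF : ∀ x, F x ≤ G.fiber t x)
    (hprep : ∀ p x, x ∈ G.cylinder (Path.vertex p.s) → ∀ ξ ∈ F x, t p ξ ∈ F (G.prepend p x))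
    (hshift : ∀ p x, x ∈ G.cylinder p → ∀ ξ ∈ F x, star (t p) ξ ∈ F (x.shift (G.degree p)))
    {x : G.InfPath} (hx : F x ≠ ⊥) : (⨆ x, F x).topologicalClosure = ⊤ := by
  have hinv : ∀ A : H →L[ℂ] H, (∀ x, ∀ ξ ∈ F x, A ξ ∈ ⨆ x, F x) →
      ∀ ξ ∈ (⨆ x, F x).topologicalClosure, A ξ ∈ (⨆ x, F x).topologicalClosure := by
    intro A hA
    have h1 : (⨆ x, F x) ≤ (⨆ x, F x).comap (A : H →ₗ[ℂ] H) := iSup_le hA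
    intro ξ hξ
    exact map_mem_closure A.continuous hξ h1
  refine (hirr _ (Submodule.isClosed_topologicalClosure _) fun p ξ hξ => ⟨?_, ?_⟩).resolve_left ?_
  · refine hinv _ (fun x ξ hξ => ?_) ξ hξ
    by_cases h : x ∈ G.cylinder (Path.vertex p.s)
    · exact Submodule.mem_iSup_of_mem _ (hprep p x h ξ hξ)
    · rw [ht.apply_eq_zero_of_notMem h (hF x hξ)]; exact Submodule.zero_mem _
  · refine hinv _ (fun x ξ hξ => ?_) ξ hξ
    by_cases h : x ∈ G.cylinder p
    · exact Submodule.mem_iSup_of_mem _ (hshift p x h ξ hξ)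
    · rw [ht.star_eq_zero_of_notMem h (hF x hξ)]; exact Submodule.zero_mem _
  · intro h
    exact hx (le_bot_iff.1 (h ▸ (le_iSup F x).trans (Submodule.le_topologicalClosure _)))

/-- The vectors carried by `y` all of whose transports to `x` lie in `K`. -/
def KGraph.transportField (t : Path Λ → (H →L[ℂ] H)) (x : G.InfPath) (K : Submodule ℂ H)
    (y : G.InfPath) : Submodule ℂ H :=
  G.fiber t y ⊓ ⨅ (m : Fin k → ℕ) (n : Fin k → ℕ) (_ : y.shift m = x.shift n),
    K.comap ((t (x.segment 0 n zero_le) * star (t (y.segment 0 m zero_le)) : H →L[ℂ] H) :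
      H →ₗ[ℂ] H)

theorem KGraph.mem_transportField {x y : G.InfPath} {K : Submodule ℂ H} {ξ : H} :
    ξ ∈ G.transportField t x K y ↔ ξ ∈ G.fiber t y ∧ ∀ m n, y.shift m = x.shift n →
      t (x.segment 0 n zero_le) (star (t (y.segment 0 m zero_le)) ξ) ∈ K := by
  simp [transportField]

/-- The operators between vectors carried by `x` act irreducibly. -/
theorem KGraph.IsOrthogonalFamily.eq_fiber_of_invariant (ht : G.IsOrthogonalFamily t)
    (hirr : IsIrreducibleFamily t) {x : G.InfPath} {K : Submodule ℂ H} (hKc : IsClosed (K : Set H))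
    (hK : K ≤ G.fiber t x)
    (hinv : ∀ m n, x.shift m = x.shift n → ∀ ξ ∈ K,
      t (x.segment 0 n zero_le) (star (t (x.segment 0 m zero_le)) ξ) ∈ K) (h0 : K ≠ ⊥) :
    K = G.fiber t x := by
  -- `K` extends to an invariant field of subspaces whose value at `x` is `K` itself; its span is
  -- dense by irreducibility.
  set F := G.transportField t x K with hF
  have hxK : F x = K := by
    ext ξ
    rw [hF, mem_transportField]
    constructor
    · rintro ⟨h1, h2⟩
      rw [← h1 0]; exact h2 0 0 rfl
    · exact fun h => ⟨hK h, fun m n hmn => hinv m n hmn ξ h⟩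
  have hFle : ∀ y, F y ≤ G.fiber t y := fun y => inf_le_left
  have htop := ht.closure_iSup_eq_top hirr F hFle (x := x) (by
      intro p y hy ξ hξ
      rw [hF, mem_transportField] at hξ ⊢
      refine ⟨ht.apply_mem hy hξ.1, fun m n hmn => ?_⟩
      -- Lengthening the transport by `d(p)` makes the removed segment of `py` begin with `p`, so
      -- that `star (t p)` cancels `t p`.
      rw [← ht.transport_stable hmn (G.degree p) (ht.apply_mem hy hξ.1)]
      have hle : G.degree p ≤ m + G.degree p := le_add_of_nonneg_left zero_le
      have hp : (G.prepend p y).segment 0 (G.degree p) zero_le = p := G.prepend_mem hy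
      have hq : (G.prepend p y).segment (G.degree p) (m + G.degree p) hle =
          y.segment 0 m zero_le := by
        conv_rhs => rw [← G.shift_prepend hy]
        rw [InfPath.segment_shift]; exact InfPath.segment_congr _ _ (zero_add _).symm rfl
      have hv : t (Path.vertex p.s) ξ = ξ := by
        have := ht.vertex_of_mem hξ.1
        rwa [InfPath.mem_cylinder_vertex.1 hy] at this
      rw [← ht.star_segment_apply _ zero_le hle, hp, hq, ht.star_apply_self, hv]
      apply hξ.2
      have h3 := congrArg (InfPath.shift (G.degree p)) hmn
      rw [InfPath.shift_shift, InfPath.shift_shift, add_comm, ← InfPath.shift_shift,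
        G.shift_prepend hy] at h3
      rw [h3, add_comm])
    (by
      intro p y hy ξ hξ
      rw [hF, mem_transportField] at hξ ⊢
      refine ⟨ht.star_mem hy hξ.1, fun m n hmn => ?_⟩
      have hle : G.degree p ≤ m + G.degree p := le_add_of_nonneg_left zero_le
      have hp : y.segment 0 (G.degree p) zero_le = p := hy
      have hq : (y.shift (G.degree p)).segment 0 m zero_le =
          y.segment (G.degree p) (m + G.degree p) hle := by
        rw [InfPath.segment_shift]; exact InfPath.segment_congr _ _ (zero_add _) rfl
      have h4 := hξ.2 (m + G.degree p) n (by rw [← InfPath.shift_shift, hmn])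
      rwa [← ht.star_segment_apply _ zero_le hle, hp, ← hq] at h4)
    (by rwa [hxK])
  have : CompleteSpace K := hKc.completeSpace_coe
  refine le_antisymm hK fun ζ hζ => ?_
  -- The component `ζ'` orthogonal to `K` still lies in the fiber of `x`. It is orthogonal to `F x =
  -- K` and to all other fibers, hence to a dense subspace, and vanishes.
  obtain ⟨κ, hκ, ζ', hζ', rfl⟩ := K.exists_add_mem_mem_orthogonal ζ
  have hζf : ζ' ∈ G.fiber t x := by
    have := Submodule.sub_mem _ hζ (hK hκ)
    rwa [add_sub_cancel_left] at this
  have horth : (⨆ y, F y) ≤ (ℂ ∙ ζ')ᗮ := by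
    refine iSup_le fun y η hη => ?_
    rw [Submodule.mem_orthogonal_singleton_iff_inner_right]
    by_cases hxy : x = y
    · subst hxy
      rw [hxK] at hη
      exact (Submodule.mem_orthogonal' K ζ').1 hζ' η hη
    · exact ht.inner_eq_zero hxy hζf (hFle y hη)
  have h5 := Submodule.topologicalClosure_minimal _ horth (Submodule.isClosed_orthogonal _)
  rw [htop] at h5
  have h6 : ζ' ∈ (ℂ ∙ ζ')ᗮ := h5 Submodule.mem_top
  rw [Submodule.mem_orthogonal_singleton_iff_inner_right, inner_self_eq_zero] at h6
  rw [h6, add_zero]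
  exact hκ

/-- The vectors carried by an infinite path form a space of dimension at most one. -/
theorem KGraph.IsOrthogonalFamily.fiber_le_span (ht : G.IsOrthogonalFamily t)
    (hirr : IsIrreducibleFamily t) {x : G.InfPath} {ξ : H} (hξ : ξ ∈ G.fiber t x) (h0 : ξ ≠ 0) :
    G.fiber t x ≤ ℂ ∙ ξ := by
  set E := G.fiber t x with hE
  have hEc : IsClosed (E : Set H) := G.isClosed_fiber x
  have : CompleteSpace E := hEc.completeSpace_coe
  let V : ∀ m n, x.shift m = x.shift n → (E →L[ℂ] E) := fun m n h =>
    (t (x.segment 0 n zero_le) * star (t (x.segment 0 m zero_le))).restrict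
      (fun ξ hξ => ht.transport_mem h hξ)
  have hV : ∀ m n h (η : E), (V m n h η : H) =
    t (x.segment 0 n zero_le) (star (t (x.segment 0 m zero_le)) η) := fun _ _ _ _ => rfl
  have hscalar := exists_eq_smul_one_of_commute {T | ∃ m n h, T = V m n h}
    (by
      rintro _ ⟨m, n, h, rfl⟩ _ ⟨m', n', h', rfl⟩
      refine ContinuousLinearMap.ext fun η => Subtype.ext ?_
      simp only [mul_apply_eq_comp, hV]
      rw [ht.transport_transport h h' η.2, ht.transport_transport h' h η.2]
      rw [x.segment_congr (zero_le : 0 ≤ m + m') rfl (add_comm m m'),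
        x.segment_congr (zero_le : 0 ≤ n + n') rfl (add_comm n n')])
    (by
      rintro _ ⟨m, n, h, rfl⟩
      refine ⟨n, m, h.symm, ?_⟩
      rw [ContinuousLinearMap.star_eq_adjoint, eq_comm, ContinuousLinearMap.eq_adjoint_iff]
      intro a b
      rw [Submodule.coe_inner, Submodule.coe_inner, hV n m h.symm, hV m n h]
      simp only [ContinuousLinearMap.star_eq_adjoint]
      rw [ContinuousLinearMap.adjoint_inner_right _ _ (b : H) |>.symm,
        ContinuousLinearMap.adjoint_inner_left])
    (by
      intro K hKc hK
      by_cases hb : K = ⊥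
      · exact Or.inl hb
      right
      have hmap := ht.eq_fiber_of_invariant hirr (x := x) (K := K.map E.subtype)
        (by
          rw [Submodule.map_coe]
          exact hEc.isClosedEmbedding_subtypeVal.isClosedMap _ hKc)
        (Submodule.map_subtype_le _ _)
        (by
          rintro m n h _ ⟨η, hη, rfl⟩
          exact ⟨V m n h η, hK _ ⟨m, n, h, rfl⟩ η hη, rfl⟩)
        (by
          intro hm
          refine hb (eq_bot_iff.2 fun η hη => Subtype.ext ?_)
          have : (η : H) ∈ K.map E.subtype := ⟨η, hη, rfl⟩
          rwa [hm, Submodule.mem_bot] at this)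
      rw [eq_top_iff]
      intro η _
      have : (η : H) ∈ K.map E.subtype := hmap ▸ η.2
      obtain ⟨η', h1, h2⟩ := this
      rwa [← Subtype.ext h2])
  -- As all transports are scalar on the fiber, every line in it is invariant, hence is the whole
  -- fiber.
  have hspan : (ℂ ∙ ξ) = E := by
    refine ht.eq_fiber_of_invariant hirr (Submodule.closed_of_finiteDimensional _)
      ((Submodule.span_singleton_le_iff_mem _ _).2 hξ) (fun m n h η hη => ?_) (by simpa using h0)
    have hηE : η ∈ E := (Submodule.span_singleton_le_iff_mem _ _).2 hξ hη
    obtain ⟨c, hc⟩ := hscalar (V m n h) ⟨m, n, h, rfl⟩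
    have := congrArg (fun A : E →L[ℂ] E => (A ⟨η, hηE⟩ : H)) hc
    change t _ (star (t _) η) = c • η at this
    rw [this]
    exact Submodule.smul_mem _ _ hη
  exact hspan.ge

/-- The vectors carried by the infinite paths in the orbit of `x` span a dense subspace. -/
theorem KGraph.IsOrthogonalFamily.closure_iSup_fiber (ht : G.IsOrthogonalFamily t)
    (hirr : IsIrreducibleFamily t) {x : G.InfPath} (hx : G.fiber t x ≠ ⊥) :
    (⨆ y ∈ G.orbit x, G.fiber t y).topologicalClosure = ⊤ := by
  -- The supremum over the proposition `y ∈ G.orbit x` encodes the field that is the fiber on the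
  -- orbit and zero elsewhere.
  refine ht.closure_iSup_eq_top hirr (fun y => ⨆ _ : y ∈ G.orbit x, G.fiber t y)
    (fun y => iSup_le fun _ => le_rfl) ?_ ?_ (x := x) ?_
  · intro p y hy ξ hξ
    by_cases h : y ∈ G.orbit x
    · have h' : G.prepend p y ∈ G.orbit x := by
        rw [← G.mem_orbit_of_shift (G.degree p), G.shift_prepend hy]; exact h
      simp only [h, h', iSup_pos] at hξ ⊢
      exact ht.apply_mem hy hξ
    · simp only [h, iSup_neg, not_false_eq_true, Submodule.mem_bot] at hξ
      rw [hξ, map_zero]; exact Submodule.zero_mem _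
  · intro p y hy ξ hξ
    by_cases h : y ∈ G.orbit x
    · have h' : y.shift (G.degree p) ∈ G.orbit x := (G.mem_orbit_of_shift _).2 h
      simp only [h, h', iSup_pos] at hξ ⊢
      exact ht.star_mem hy hξ
    · simp only [h, iSup_neg, not_false_eq_true, Submodule.mem_bot] at hξ
      rw [hξ, map_zero]; exact Submodule.zero_mem _
  · have h : x ∈ G.orbit x := ⟨0, 0, rfl⟩
    simpa only [h, iSup_pos] using hx

/-- Only countably many infinite paths carry nonzero vectors. -/
theorem KGraph.IsOrthogonalFamily.fiber_eq_bot (ht : G.IsOrthogonalFamily t)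
    (hirr : IsIrreducibleFamily t) {x y : G.InfPath} (hx : G.fiber t x ≠ ⊥)
    (hy : y ∉ G.orbit x) : G.fiber t y = ⊥ := by
  rw [eq_bot_iff]
  intro ξ hξ
  have horth : (⨆ z ∈ G.orbit x, G.fiber t z) ≤ (ℂ ∙ ξ)ᗮ := by
    refine iSup₂_le fun z hz η hη => ?_
    rw [Submodule.mem_orthogonal_singleton_iff_inner_right]
    exact ht.inner_eq_zero (fun h => hy (by rwa [h])) hξ hη
  have h5 := Submodule.topologicalClosure_minimal _ horth (Submodule.isClosed_orthogonal _)
  rw [ht.closure_iSup_fiber hirr hx] at h5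
  have h6 : ξ ∈ (ℂ ∙ ξ)ᗮ := h5 Submodule.mem_top
  rw [Submodule.mem_orthogonal_singleton_iff_inner_right, inner_self_eq_zero] at h6
  exact h6

end

/-! ### Orthonormal bases of vectors carried by infinite paths -/

section

variable {G : KGraph k Λ} {H : Type*} [NormedAddCommGroup H] [InnerProductSpace ℂ H]
  [CompleteSpace H] {t : Path Λ → (H →L[ℂ] H)}

/-- The infinite paths that carry nonzero vectors. -/
def KGraph.support (G : KGraph k Λ) (t : Path Λ → (H →L[ℂ] H)) : Set G.InfPath :=
  {x | G.fiber t x ≠ ⊥}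

namespace KGraph.IsOrthogonalFamily

variable (ht : G.IsOrthogonalFamily t)
include ht

theorem countable_support (hirr : IsIrreducibleFamily t) : (G.support t).Countable := by
  rcases (G.support t).eq_empty_or_nonempty with h | ⟨x, hx⟩
  · rw [h]; exact Set.countable_empty
  · refine (G.orbit_countable x).mono fun y hy => ?_
    by_contra h
    exact hy (ht.fiber_eq_bot hirr hx h)

theorem norm_apply {x : G.InfPath} {p : Path Λ} (hx : x ∈ G.cylinder (Path.vertex p.s)) {ξ : H}
    (hξ : ξ ∈ G.fiber t x) : ‖t p ξ‖ = ‖ξ‖ := by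
  have hv : t (Path.vertex p.s) ξ = ξ := by
    have := ht.vertex_of_mem hξ
    rwa [InfPath.mem_cylinder_vertex.1 hx] at this
  have h : inner ℂ (t p ξ) (t p ξ) = inner ℂ ξ ξ := by
    rw [← ContinuousLinearMap.adjoint_inner_right, ← ContinuousLinearMap.star_eq_adjoint,
      ht.star_apply_self, hv]
  rw [inner_self_eq_norm_sq_to_K, inner_self_eq_norm_sq_to_K] at h
  have h2 : ‖t p ξ‖ ^ 2 = ‖ξ‖ ^ 2 := by exact_mod_cast h
  exact (sq_eq_sq₀ (norm_nonneg _) (norm_nonneg _)).1 h2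

/-- On the fiber of `x` the operator `t p` is isometric, and on the fiber of `px` its adjoint is
injective, since `t p * star (t p)` is the identity there. -/
theorem prepend_mem_support {x : G.InfPath} {p : Path Λ}
    (hx : x ∈ G.cylinder (Path.vertex p.s)) :
    G.prepend p x ∈ G.support t ↔ x ∈ G.support t := by
  constructor
  · intro h
    obtain ⟨ξ, hξ, h0⟩ := (Submodule.ne_bot_iff _).1 h
    refine (Submodule.ne_bot_iff _).2 ⟨star (t p) ξ, ?_, fun h1 => h0 ?_⟩
    · have := ht.star_mem (G.prepend_mem hx) hξ
      rwa [G.shift_prepend hx] at this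
    · have h2 := hξ (G.degree p)
      rw [show (G.prepend p x).segment 0 (G.degree p) zero_le = p from G.prepend_mem hx, h1,
        map_zero] at h2
      exact h2.symm
  · intro h
    obtain ⟨ξ, hξ, h0⟩ := (Submodule.ne_bot_iff _).1 h
    refine (Submodule.ne_bot_iff _).2 ⟨t p ξ, ht.apply_mem hx hξ, ?_⟩
    rw [← norm_ne_zero_iff, ht.norm_apply hx hξ]
    exact norm_ne_zero_iff.2 h0

theorem segment_prefix_proj {a b c : Λ} (g : a ⟶ b) (f : b ⟶ c) {ξ : H}
    (h : t ⟨a, c, g ≫ f⟩ (star (t ⟨a, c, g ≫ f⟩) ξ) = ξ) :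
    t ⟨b, c, f⟩ (star (t ⟨b, c, f⟩) ξ) = ξ := by
  rw [← h, ← ht.isCK.mul_eq g f, mul_apply_eq_comp, ht.star_apply_self]
  congr 1
  exact ht.vertex_apply ⟨a, b, g⟩ _

theorem eq_of_proj {p q : Path Λ} (hd : G.degree p = G.degree q) {ξ : H} (h0 : ξ ≠ 0)
    (hp : t p (star (t p) ξ) = ξ) (hq : t q (star (t q) ξ) = ξ) : p = q := by
  by_contra h
  have : star (t p) ξ = 0 := by rw [← hq]; exact ht.star_apply_eq_zero hd h _
  rw [this, map_zero] at hp
  exact h0 hp.symm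

/-- A nonzero vector that lies in the range of some `t_p` for each degree of `p` is carried by an
infinite path. -/
theorem exists_mem_fiber {ξ : H} (h0 : ξ ≠ 0)
    (hξ : ∀ n, ∃ p, G.degree p = n ∧ t p (star (t p) ξ) = ξ) : ∃ x, ξ ∈ G.fiber t x := by
  obtain ⟨p0, hp0, hp0'⟩ := hξ 0
  have hex : ∀ n, ∃ (s : Λ) (h : s ⟶ p0.r), G.deg h = n ∧
      t ⟨s, p0.r, h⟩ (star (t ⟨s, p0.r, h⟩) ξ) = ξ := by
    intro n
    obtain ⟨⟨a, c, h⟩, hd, hp⟩ := hξ n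
    -- The range vertex of every path found is the one of `p0`: two paths of degree 0 whose
    -- projections fix the same nonzero vector coincide.
    have e := ht.eq_of_proj (G.degree_vertex c |>.trans hp0.symm) h0
      (ht.segment_prefix_proj h (𝟙 c) (by rwa [Category.comp_id])) hp0'
    have hc : c = p0.r := congrArg Path.r e
    subst hc
    exact ⟨a, h, hd, hp⟩
  choose s h hd hp using hex
  obtain ⟨x, hx⟩ := InfPath.exists_of_compatible G p0.r s h hd (by
    intro m n hmn
    obtain ⟨⟨b, g, f⟩, ⟨h1, h2, h3⟩, -⟩ := G.factorization (h n) m (n - m)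
      (by rw [hd, add_tsub_cancel_of_le hmn])
    dsimp only at h1 h2 h3
    have hpn := hp n
    rw [← h1] at hpn ⊢
    have e := ht.eq_of_proj (p := ⟨b, p0.r, f⟩) (q := ⟨s m, p0.r, h m⟩)
      (h2.trans (hd m).symm) h0 (ht.segment_prefix_proj g f hpn) (hp m)
    rw [Path.mk.injEq] at e
    obtain ⟨rfl, -, e⟩ := e
    exact ⟨g, by rw [eq_of_heq e]⟩)
  exact ⟨x, fun n => by rw [hx]; exact hp n⟩

/-- A choice of unit vectors in the nonzero fibers is an orthonormal basis. -/
theorem exists_hilbertBasis (hirr : IsIrreducibleFamily t) (hne : (G.support t).Nonempty)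
    (e : G.support t → H) (hmem : ∀ y, e y ∈ G.fiber t y.1) (hnorm : ∀ y, ‖e y‖ = 1) :
    ∃ b : HilbertBasis (G.support t) ℂ H, ⇑b = e := by
  have horth : Orthonormal ℂ e :=
    ⟨hnorm, fun y z hyz => ht.inner_eq_zero (fun h => hyz (Subtype.ext h)) (hmem y) (hmem z)⟩
  refine ⟨HilbertBasis.mk horth ?_, HilbertBasis.coe_mk _ _⟩
  obtain ⟨x, hx⟩ := hne
  rw [← ht.closure_iSup_fiber hirr hx]
  refine Submodule.topologicalClosure_mono (iSup₂_le fun y _ => ?_)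
  by_cases hy : G.fiber t y = ⊥
  · rw [hy]; exact bot_le
  · refine (ht.fiber_le_span hirr (hmem ⟨y, hy⟩) ?_).trans
      (Submodule.span_mono (Set.singleton_subset_iff.2 ⟨⟨y, hy⟩, rfl⟩))
    rw [← norm_ne_zero_iff, hnorm]; exact one_ne_zero

open Classical in
theorem inner_proj {x : G.InfPath} {e : H} (he : e ∈ G.fiber t x) (p : Path Λ) (ξ : H) :
    inner ℂ e ((t p * star (t p)) ξ) = if x ∈ G.cylinder p then inner ℂ e ξ else 0 := by
  rw [mul_apply_eq_comp, ← ContinuousLinearMap.adjoint_inner_left,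
    ← ContinuousLinearMap.star_eq_adjoint]
  split_ifs with h
  · have := he (G.degree p)
    rw [show x.segment 0 (G.degree p) zero_le = p from h] at this
    rw [ContinuousLinearMap.star_eq_adjoint, ContinuousLinearMap.adjoint_inner_right,
      ← ContinuousLinearMap.star_eq_adjoint, this]
  · rw [ht.star_eq_zero_of_notMem h he, inner_zero_left]

/-- The coordinates of a monic vector do not vanish. -/
theorem inner_ne_zero {x : G.InfPath} {e : H} (he : e ∈ G.fiber t x) (h0 : e ≠ 0) {ξ : H}
    (hξ : (Submodule.span ℂ (Set.range fun p : Path Λ =>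
      (t p * star (t p)) ξ)).topologicalClosure = ⊤) : inner ℂ e ξ ≠ 0 := by
  classical
  intro h
  have h1 : Submodule.span ℂ (Set.range fun p : Path Λ => (t p * star (t p)) ξ) ≤ (ℂ ∙ e)ᗮ := by
    rw [Submodule.span_le]
    rintro _ ⟨p, rfl⟩
    rw [SetLike.mem_coe, Submodule.mem_orthogonal_singleton_iff_inner_right, ht.inner_proj he, h,
      ite_self]
  have h2 := Submodule.topologicalClosure_minimal _ h1 (Submodule.isClosed_orthogonal _)
  rw [hξ] at h2
  have h3 : e ∈ (ℂ ∙ e)ᗮ := h2 Submodule.mem_top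
  rw [Submodule.mem_orthogonal_singleton_iff_inner_right, inner_self_eq_zero] at h3
  exact h0 h3

/-- A vector with nonvanishing coordinates is monic. -/
theorem closure_span_proj (b : HilbertBasis (G.support t) ℂ H)
    (hb : ∀ y, b y ∈ G.fiber t y.1) (ξ : H) (hξ : ∀ y, inner ℂ (b y) ξ ≠ 0) :
    (Submodule.span ℂ (Set.range fun p : Path Λ =>
      (t p * star (t p)) ξ)).topologicalClosure = ⊤ := by
  classical
  rw [Submodule.topologicalClosure_eq_top_iff, eq_bot_iff]
  intro η hη
  have h0 : ∀ p, inner ℂ η ((t p * star (t p)) ξ) = 0 := fun p =>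
    (Submodule.mem_orthogonal' _ _).1 hη _ (Submodule.subset_span ⟨p, rfl⟩)
  have hcoord : ∀ y, inner ℂ η (b y) = 0 := by
    intro y
    -- These are the Parseval terms of `⟨η, ξ⟩`. Restricted to the paths in `Z(p)` they sum to `⟨η,
    -- t p (star (t p) ξ)⟩ = 0`. The cylinders of the diagonal segments of `y` shrink to `y`, and
    -- dominated convergence leaves the single term at `y`.
    let g : G.support t → ℂ := fun z => inner ℂ η (b z) * inner ℂ (b z) ξ
    let p : ℕ → Path Λ := fun N => y.1.segment 0 (fun _ => N) zero_le
    have hlim : Filter.Tendsto (fun N => ∑' z, if z.1 ∈ G.cylinder (p N) then g z else 0)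
        Filter.atTop (nhds (∑' z, if z = y then g z else 0)) := by
      refine tendsto_tsum_of_dominated_convergence (bound := fun z => ‖g z‖)
        (b.summable_inner_mul_inner η ξ).norm (fun z => ?_) (Filter.Eventually.of_forall
          fun N z => by split_ifs <;> simp)
      by_cases hz : z = y
      · subst hz
        simp [p, InfPath.mem_cylinder_segment]
      · rw [if_neg hz]
        obtain ⟨n, hn⟩ : ∃ n, z.1.segment 0 n zero_le ≠ y.1.segment 0 n zero_le := by
          by_contra! h; exact hz (Subtype.ext (InfPath.ext_segment h))
        refine tendsto_const_nhds.congr' ?_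
        -- For `N ≥ ∑ n_i` the degree `(N, ..., N)` dominates `n`, where the two paths already
        -- differ.
        filter_upwards [Filter.eventually_ge_atTop (∑ i, n i)] with N hN
        rw [if_neg]
        intro hmem
        refine hn (InfPath.segment_prefix (n := fun _ => N) (fun i => ?_) ?_)
        · exact (Finset.single_le_sum (fun _ _ => Nat.zero_le _) (Finset.mem_univ i)).trans hN
        · refine Eq.trans ?_ hmem
          exact InfPath.segment_congr _ _ rfl (by rw [InfPath.degree_segment, tsub_zero])
    have hz : ∀ N, ∑' z : G.support t, (if z.1 ∈ G.cylinder (p N) then g z else 0) = 0 := by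
      intro N
      refine Eq.trans (tsum_congr fun z => ?_) ((b.tsum_inner_mul_inner η _).trans (h0 (p N)))
      rw [ht.inner_proj (hb z)]
      split_ifs with h
      · rfl
      · rw [mul_zero]
    simp only [hz, tsum_ite_eq] at hlim
    have := tendsto_nhds_unique hlim tendsto_const_nhds
    exact (mul_eq_zero.1 this).resolve_right (hξ y)
  have : inner ℂ η η = 0 := by
    rw [← b.tsum_inner_mul_inner]; simp [hcoord]
  exact inner_self_eq_zero.1 this

/-- The support is countable, so it carries a summable family of positive numbers; their square
roots serve as coordinates. -/
theorem exists_cyclic (hirr : IsIrreducibleFamily t) (b : HilbertBasis (G.support t) ℂ H)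
    (hb : ∀ y, b y ∈ G.fiber t y.1) :
    ∃ ξ : H, (Submodule.span ℂ (Set.range fun p : Path Λ =>
      (t p * star (t p)) ξ)).topologicalClosure = ⊤ := by
  have : Countable (G.support t) := ht.countable_support hirr
  have := Encodable.ofCountable (G.support t)
  obtain ⟨c, hc, s, hs, -⟩ := posSumOfEncodable (ε := 1) one_pos (G.support t)
  let f : lp (fun _ : G.support t => ℂ) 2 := ⟨fun y => ((Real.sqrt (c y) : ℝ) : ℂ), by
    refine memℓp_gen ?_
    simp only [Complex.norm_real, Real.norm_eq_abs, abs_of_nonneg (Real.sqrt_nonneg _)]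
    refine hs.summable.congr fun y => ?_
    rw [ENNReal.toReal_ofNat, Real.rpow_two, Real.sq_sqrt (hc y).le]⟩
  refine ⟨b.repr.symm f, ht.closure_span_proj b hb _ fun y => ?_⟩
  rw [← b.repr_apply_apply, LinearIsometryEquiv.apply_symm_apply]
  exact Complex.ofReal_ne_zero.2 (Real.sqrt_ne_zero'.2 (hc y))

end KGraph.IsOrthogonalFamily

end

/-! ### Families of operators from representations -/

theorem KGraph.isCKFamily_map {G : KGraph k Λ} (hrow : G.RowFinite) {H : Type*}
    [NormedAddCommGroup H] [InnerProductSpace ℂ H] [CompleteSpace H]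
    (π : KGraph.CStar.{u} G →⋆ₙₐ[ℂ] (H →L[ℂ] H)) : G.IsCKFamily fun p => π (G.gen p) := by
  have h := KGraph.isCKFamily_gen.{u} G hrow
  refine ⟨fun p => ?_, fun v => ⟨?_, ?_⟩, fun v v' hv => ?_, fun g f => ?_, fun p => ?_,
    fun v n => ?_⟩
  · rw [← map_star, ← map_mul, ← map_mul, h.partial_isometry]
  · exact (map_mul π _ _).symm.trans (congrArg π (h.vertex_proj v).isIdempotentElem)
  · exact (map_star π _).symm.trans (congrArg π (h.vertex_proj v).isSelfAdjoint)
  · rw [← map_mul, h.vertex_orthogonal v v' hv, map_zero]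
  · rw [← map_mul, h.mul_eq]
  · rw [← map_star, ← map_mul, h.star_mul_self]
  · rw [h.sum_eq v n, finsum_mem_eq_finite_toFinset_sum _ (hrow v n),
      finsum_mem_eq_finite_toFinset_sum _ (hrow v n), map_sum]
    exact Finset.sum_congr rfl fun p _ => by rw [map_mul, map_star]

/-- A property of elements of `C*(Λ)` that holds for the generators and is preserved by the
algebraic operations and by limits holds for all elements. -/
theorem KGraph.cstar_induction {G : KGraph k Λ} {P : KGraph.CStar.{u} G → Prop}
    (hgen : ∀ p, P (G.gen p)) (hadd : ∀ a b, P a → P b → P (a + b)) (hzero : P 0)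
    (hmul : ∀ a b, P a → P b → P (a * b)) (hsmul : ∀ (c : ℂ) a, P a → P (c • a))
    (hstar : ∀ a, P a → P (star a)) (hclosed : IsClosed {a | P a}) (a : KGraph.CStar.{u} G) :
    P a := by
  have hle := NonUnitalStarSubalgebra.le_topologicalClosure
    (NonUnitalStarAlgebra.adjoin ℂ (Set.range (KGraph.preGen.{u} G)))
  have hadj : ∀ b (hb : b ∈ NonUnitalStarAlgebra.adjoin ℂ (Set.range (KGraph.preGen.{u} G))),
      P ⟨b, hle hb⟩ := by
    intro b hb
    induction hb using NonUnitalStarAlgebra.adjoin_induction with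
    | mem x hx => obtain ⟨p, rfl⟩ := hx; exact hgen p
    | add x y hx hy h1 h2 => exact hadd _ _ h1 h2
    | zero => exact hzero
    | mul x y hx hy h1 h2 => exact hmul _ _ h1 h2
    | smul r x hx h => exact hsmul r _ h
    | star x hx h => exact hstar _ h
  have hmem : a ∈ closure {b : KGraph.CStar.{u} G |
      (b : KGraph.CKProduct.{u} G) ∈
        NonUnitalStarAlgebra.adjoin ℂ (Set.range (KGraph.preGen.{u} G))} := by
    rw [closure_subtype]
    refine closure_mono ?_ a.2
    intro b hb
    exact ⟨⟨b, hle hb⟩, hb, rfl⟩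
  exact closure_minimal (fun b hb => hadj b.1 hb) hclosed hmem

/-- Invariance under generators and their adjoints propagates to all of `C*(Λ)`. The induction
treats `a` and `star a` together, since it also passes through adjoints. -/
theorem IsIrreducible.isIrreducibleFamily {G : KGraph k Λ} {H : Type*}
    [NormedAddCommGroup H] [InnerProductSpace ℂ H] [CompleteSpace H]
    {π : KGraph.CStar.{u} G →⋆ₙₐ[ℂ] (H →L[ℂ] H)} (h : IsIrreducible π) :
    IsIrreducibleFamily fun p => π (G.gen p) := by
  intro K hKc hK
  have hcont : Continuous π :=
    AddMonoidHomClass.continuous_of_bound π 1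
      (by simpa only [one_mul] using NonUnitalStarAlgHom.norm_apply_le π)
  have hinv : ∀ a, (∀ ξ ∈ K, π a ξ ∈ K) ∧ ∀ ξ ∈ K, π (star a) ξ ∈ K := by
    intro a
    induction a using KGraph.cstar_induction with
    | hgen p => exact ⟨fun ξ hξ => (hK p ξ hξ).1, fun ξ hξ => by
        rw [map_star]; exact (hK p ξ hξ).2⟩
    | hadd a b ha hb =>
      refine ⟨fun ξ hξ => ?_, fun ξ hξ => ?_⟩
      · rw [map_add]; exact K.add_mem (ha.1 ξ hξ) (hb.1 ξ hξ)
      · rw [star_add, map_add]; exact K.add_mem (ha.2 ξ hξ) (hb.2 ξ hξ)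
    | hzero => simp
    | hmul a b ha hb =>
      refine ⟨fun ξ hξ => ?_, fun ξ hξ => ?_⟩
      · rw [map_mul]; exact ha.1 _ (hb.1 ξ hξ)
      · rw [star_mul, map_mul]; exact hb.2 _ (ha.2 ξ hξ)
    | hsmul c a ha =>
      refine ⟨fun ξ hξ => ?_, fun ξ hξ => ?_⟩
      · rw [map_smul]; exact K.smul_mem c (ha.1 ξ hξ)
      · rw [star_smul, map_smul]; exact K.smul_mem _ (ha.2 ξ hξ)
    | hstar a ha => exact ⟨ha.2, by rw [star_star]; exact ha.1⟩
    | hclosed =>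
      have e : {a : KGraph.CStar.{u} G | (∀ ξ ∈ K, π a ξ ∈ K) ∧ ∀ ξ ∈ K, π (star a) ξ ∈ K} =
          ⋂ ξ : K, {a | π a ξ ∈ K} ∩ {a | π (star a) ξ ∈ K} := by
        ext a
        simp only [Set.mem_ofPred_eq, Set.mem_iInter, Set.mem_inter_iff, Subtype.forall]
        exact ⟨fun h ξ hξ => ⟨h.1 ξ hξ, h.2 ξ hξ⟩,
          fun h => ⟨fun ξ hξ => (h ξ hξ).1, fun ξ hξ => (h ξ hξ).2⟩⟩
      rw [e]
      have hc : ∀ ξ : H, Continuous fun a : KGraph.CStar.{u} G => π a ξ := fun ξ =>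
        (ContinuousLinearMap.apply ℂ H ξ).continuous.comp hcont
      exact isClosed_iInter fun ξ => (hKc.preimage (hc ξ)).inter
        (hKc.preimage ((hc ξ).comp continuous_star))
  exact h.2 K hKc fun a => (hinv a).1

/-! ### Semibranching function systems and their representations -/

section SBFS

variable {G : KGraph k Λ} {X : Type u} [MeasurableSpace X] {μ : Measure X} (S : G.SBFS X μ)

theorem KGraph.SBFS.measurableSet_range (p : Path Λ) : MeasurableSet (S.range p) :=
  (S.semibranching (G.degree p)).measurableSet_range ⟨p, rfl⟩

theorem KGraph.SBFS.measurableSet_dom (p : Path Λ) : MeasurableSet (S.dom p) :=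
  (S.semibranching (G.degree p)).measurableSet_dom ⟨p, rfl⟩

theorem KGraph.SBFS.coding_tau (p : Path Λ) {x : X} (hx : x ∈ S.dom p) :
    S.coding (G.degree p) (S.tau p x) = x :=
  (S.coding_map (G.degree p)).2 ⟨p, rfl⟩ x hx

theorem KGraph.SBFS.isRNDeriv (p : Path Λ) : IsRNDeriv μ (S.dom p) (S.tau p) (S.Φ p) :=
  (S.semibranching (G.degree p)).rnDeriv ⟨p, rfl⟩

theorem KGraph.SBFS.range_inter_range {p q : Path Λ} (hd : G.degree p = G.degree q)
    (hpq : p ≠ q) : μ (S.range p ∩ S.range q) = 0 :=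
  (S.semibranching (G.degree p)).range_disjoint ⟨p, rfl⟩ ⟨q, hd.symm⟩
    (fun h => hpq (congrArg Subtype.val h))

theorem KGraph.SBFS.tau_image_vertex (v : Λ) {E : Set X} (hE : E ⊆ S.dom (Path.vertex v)) :
    S.tau (Path.vertex v) '' E = E := by
  ext x
  constructor
  · rintro ⟨y, hy, rfl⟩; rwa [S.tau_vertex v y (hE hy)]
  · exact fun hx => ⟨x, hx, S.tau_vertex v x (hE hx)⟩

theorem KGraph.SBFS.range_vertex (v : Λ) : S.range (Path.vertex v) = S.dom (Path.vertex v) :=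
  S.tau_image_vertex v subset_rfl

theorem KGraph.SBFS.Φ_vertex (v : Λ) :
    ∀ᵐ x ∂μ, x ∈ S.dom (Path.vertex v) → S.Φ (Path.vertex v) x = 1 := by
  have hD := S.measurableSet_dom (Path.vertex v)
  have hlt : μ (S.dom (Path.vertex v)) < ∞ :=
    (S.semibranching (G.degree (Path.vertex v))).dom_lt_top ⟨Path.vertex v, rfl⟩
  rw [← ae_restrict_iff' hD]
  have hint : ∀ E, MeasurableSet E → E ⊆ S.dom (Path.vertex v) →
      ∫⁻ x in E, S.Φ (Path.vertex v) x ∂μ = μ E := fun E hE hED => by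
    rw [← (S.isRNDeriv (Path.vertex v)).2 E hE hED, S.tau_image_vertex v hED]
  refine AEMeasurable.ae_eq_of_forall_setLIntegral_eq (g := fun _ => 1)
    (S.isRNDeriv _).1.aemeasurable aemeasurable_const ?_ ?_ fun s hs _ => ?_
  · rw [hint _ hD subset_rfl]; exact hlt.ne
  · rw [lintegral_one, Measure.restrict_apply_univ]; exact hlt.ne
  · rw [Measure.restrict_restrict hs, hint _ (hs.inter hD) Set.inter_subset_right, lintegral_one,
      Measure.restrict_apply_univ]

/-- Almost everywhere statements can be pulled back along the coding maps. -/
theorem KGraph.SBFS.ae_coding (p : Path Λ) {P : X → Prop} (h : ∀ᵐ x ∂μ, P x) :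
    ∀ᵐ x ∂μ, x ∈ S.range p → P (S.coding (G.degree p) x) := by
  -- The derivative formula applies to measurable sets only, hence the measurable null hull; it
  -- shows that `τ_p` sends null sets to null sets.
  set N := toMeasurable μ {x | ¬P x} with hN
  have hN0 : μ N = 0 := by rw [hN, measure_toMeasurable]; exact h
  have h0 : μ (S.tau p '' (N ∩ S.dom p)) = 0 := by
    rw [(S.isRNDeriv p).2 _ ((measurableSet_toMeasurable _ _).inter (S.measurableSet_dom p))
      Set.inter_subset_right]
    exact setLIntegral_measure_zero _ _ (measure_mono_null Set.inter_subset_left hN0)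
  refine measure_mono_null ?_ h0
  intro x hx
  simp only [Set.mem_compl_iff, Set.mem_ofPred_eq, Classical.not_imp] at hx
  obtain ⟨⟨y, hy, rfl⟩, hP⟩ := hx
  rw [S.coding_tau p hy] at hP
  exact ⟨y, ⟨subset_toMeasurable _ _ hP, hy⟩, rfl⟩

/-! ### Operators of the induced representation -/

variable {S} {π : KGraph.CStar.{u} G →⋆ₙₐ[ℂ] (Lp ℂ 2 μ →L[ℂ] Lp ℂ 2 μ)}

theorem KGraph.SBFS.Induces.apply_vertex (hπ : S.Induces π) (v : Λ) (f : Lp ℂ 2 μ) :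
    π (G.gen (Path.vertex v)) f =ᵐ[μ] (S.dom (Path.vertex v)).indicator f := by
  filter_upwards [hπ (Path.vertex v) f, S.Φ_vertex v] with x h1 h2
  rw [h1, S.range_vertex]
  by_cases hx : x ∈ S.dom (Path.vertex v)
  · have h3 := S.coding_tau _ hx
    rw [S.tau_vertex v x hx] at h3
    rw [Set.indicator_of_mem hx, Set.indicator_of_mem hx, h3, h2 hx]
    simp
  · rw [Set.indicator_of_notMem hx, Set.indicator_of_notMem hx]

theorem KGraph.SBFS.Induces.apply_eq_zero (hπ : S.Induces π) (p : Path Λ) (f : Lp ℂ 2 μ) :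
    ∀ᵐ x ∂μ, x ∉ S.range p → π (G.gen p) f x = 0 := by
  filter_upwards [hπ p f] with x h hx
  rw [h, Set.indicator_of_notMem hx]

/-- The range projections are the multiplication operators by the indicators of the range sets. -/
theorem KGraph.SBFS.Induces.proj_apply (hrow : G.RowFinite) (hπ : S.Induces π) (p : Path Λ)
    (f : Lp ℂ 2 μ) :
    π (G.gen p) (star (π (G.gen p)) f) =ᵐ[μ] (S.range p).indicator f := by
  -- The adjoint is never computed. The vertex projection at `r(p)`, multiplication by the indicator
  -- of its domain, is the finite sum of the projections of the paths `q` in `r(p)Λ^{d(p)}`. The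
  -- term of `q` vanishes off `R_q`, so on `R_p` only the term of `p` survives and equals `f`.
  have hfin := hrow p.r (G.degree p)
  have hsum := (KGraph.isCKFamily_map hrow π).sum_eq p.r (G.degree p)
  rw [finsum_mem_eq_finite_toFinset_sum _ hfin] at hsum
  have hsum' := congrArg (fun A : Lp ℂ 2 μ →L[ℂ] Lp ℂ 2 μ => A f) hsum
  simp only [sum_apply, mul_apply_eq_comp] at hsum'
  have h1 := hπ.apply_vertex p.r f
  rw [hsum'] at h1
  have h2 := Lp.coeFn_finsetSum hfin.toFinset
    (fun q => π (G.gen q) (star (π (G.gen q)) f))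
  have h3 : ∀ᵐ x ∂μ, ∀ q ∈ hfin.toFinset, x ∉ S.range q →
      π (G.gen q) (star (π (G.gen q)) f) x = 0 := by
    rw [Filter.eventually_all_finset]
    exact fun q _ => hπ.apply_eq_zero q _
  have h4 : ∀ᵐ x ∂μ, ∀ q ∈ hfin.toFinset, q ≠ p → ¬(x ∈ S.range p ∩ S.range q) := by
    rw [Filter.eventually_all_finset]
    intro q hq
    by_cases hqp : q = p
    · simp [hqp]
    · have := S.range_inter_range (p := p) (q := q) (by
        have : q ∈ G.pathsInto p.r (G.degree p) := hfin.mem_toFinset.1 hq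
        exact this.2.symm) (Ne.symm hqp)
      filter_upwards [measure_eq_zero_iff_ae_notMem.1 this] with x hx _ using hx
  have h5 : ∀ᵐ x ∂μ, x ∈ S.range p → x ∈ S.dom (Path.vertex p.r) := by
    have := S.range_subset p.hom (𝟙 p.r)
    filter_upwards [measure_eq_zero_iff_ae_notMem.1 this] with x hx h
    by_contra h'
    exact hx ⟨h, h'⟩
  filter_upwards [h1, h2, h3, h4, h5] with x h1 h2 h3 h4 h5
  have hp : p ∈ hfin.toFinset := hfin.mem_toFinset.2 ⟨rfl, rfl⟩
  by_cases hx : x ∈ S.range p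
  · rw [Set.indicator_of_mem hx]
    rw [Set.indicator_of_mem (h5 hx), h2, Finset.sum_apply, Finset.sum_eq_single p] at h1
    · exact h1
    · exact fun q hq hqp => h3 q hq fun hxq => h4 q hq hqp ⟨hx, hxq⟩
    · exact fun h => absurd hp h
  · rw [Set.indicator_of_notMem hx]
    exact h3 p hp hx

/-- Range sets of the same degree meet in null sets, so the products of their indicator
multiplications vanish; the partial isometry relations transfer this to `star (t p) * t q`. -/
theorem KGraph.SBFS.Induces.isOrthogonalFamily (hrow : G.RowFinite) (hπ : S.Induces π) :
    G.IsOrthogonalFamily fun p => π (G.gen p) where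
  isCK := KGraph.isCKFamily_map hrow π
  orthogonal p q hd hpq := by
    have h := KGraph.isCKFamily_map hrow π
    have h0 : (π (G.gen p) * star (π (G.gen p))) * (π (G.gen q) * star (π (G.gen q))) = 0 := by
      refine ContinuousLinearMap.ext fun f => Lp.ext ?_
      simp only [mul_apply_eq_comp, zero_apply]
      filter_upwards [hπ.proj_apply hrow p (π (G.gen q) (star (π (G.gen q)) f)),
        hπ.proj_apply hrow q f, Lp.coeFn_zero ℂ 2 μ,
        measure_eq_zero_iff_ae_notMem.1 (S.range_inter_range hd hpq)] with x h1 h2 h3 h4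
      rw [h1, h3, Pi.zero_apply]
      by_cases hx : x ∈ S.range p
      · rw [Set.indicator_of_mem hx, h2, Set.indicator_of_notMem fun hq => h4 ⟨hx, hq⟩]
      · rw [Set.indicator_of_notMem hx]
    have h1 := congrArg star (h.partial_isometry p)
    rw [star_mul, star_mul, star_star] at h1
    rw [← h1, ← h.partial_isometry q]
    calc star (π (G.gen p)) * (π (G.gen p) * star (π (G.gen p))) *
          (π (G.gen q) * star (π (G.gen q)) * π (G.gen q))
        = star (π (G.gen p)) * ((π (G.gen p) * star (π (G.gen p))) *
          (π (G.gen q) * star (π (G.gen q)))) * π (G.gen q) := by simp only [mul_assoc]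
      _ = 0 := by rw [h0, mul_zero, zero_mul]

/-- An atom gives rise to an infinite path that carries nonzero vectors. -/
theorem KGraph.SBFS.Induces.support_nonempty (hrow : G.RowFinite) (hπ : S.Induces π)
    (hatom : HasAtom μ) : (G.support fun p => π (G.gen p)).Nonempty := by
  obtain ⟨A, hA, hA0, hsplit⟩ := hatom
  have : Countable (Path Λ) := G.countable
  have hcover : ∀ (n : Fin k → ℕ) (B : Set X), 0 < μ B →
      ∃ p, G.degree p = n ∧ 0 < μ (B ∩ S.range p) := by
    intro n B hB
    by_contra! h
    have h1 : μ (⋃ p : {p // G.degree p = n}, B ∩ S.range p) = 0 :=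
      measure_iUnion_null fun p => nonpos_iff_eq_zero.1 (h p p.2)
    rw [← Set.inter_iUnion] at h1
    have h2 : B ⊆ (B ∩ ⋃ p : {p // G.degree p = n}, S.range p) ∪
        (⋃ p : {p // G.degree p = n}, S.range p)ᶜ := by
      intro x hx
      by_cases hx' : x ∈ ⋃ p : {p // G.degree p = n}, S.range p
      · exact Or.inl ⟨hx, hx'⟩
      · exact Or.inr hx'
    exact hB.ne' (measure_mono_null h2 (measure_union_null h1 (S.semibranching n).range_cover))
  -- The atom may have infinite measure; cutting it with a range set of degree 0 gives a finite
  -- piece whose indicator is in `L²`.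
  obtain ⟨p0, -, hp0⟩ := hcover 0 A hA0
  have hA' : MeasurableSet (A ∩ S.range p0) := hA.inter (S.measurableSet_range p0)
  have hfin : μ (A ∩ S.range p0) ≠ ∞ := ne_top_of_le_ne_top
    ((S.semibranching (G.degree p0)).range_lt_top ⟨p0, rfl⟩).ne
    (measure_mono Set.inter_subset_right)
  obtain ⟨x, hx⟩ := (hπ.isOrthogonalFamily hrow).exists_mem_fiber
    (ξ := indicatorConstLp 2 hA' hfin (1 : ℂ)) (by
      intro h
      have := norm_indicatorConstLp (μ := μ) (c := (1 : ℂ)) (hs := hA') (hμs := hfin)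
        two_ne_zero ENNReal.ofNat_ne_top
      rw [h, norm_zero, norm_one, one_mul] at this
      have h2 : 0 < μ.real (A ∩ S.range p0) := ENNReal.toReal_pos hp0.ne' hfin
      exact (Real.rpow_pos_of_pos h2 _).ne this) (by
    intro n
    obtain ⟨p, hp, hpos⟩ := hcover n _ hp0
    refine ⟨p, hp, Lp.ext ?_⟩
    -- The part of the atom in `R_{p0}` and `R_p` has positive measure, so it exhausts the atom.
    have hnull : μ (A \ (A ∩ S.range p0 ∩ S.range p)) = 0 :=
      (hsplit _ (Set.inter_subset_left.trans Set.inter_subset_left)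
        (hA'.inter (S.measurableSet_range p))).resolve_left hpos.ne'
    filter_upwards [hπ.proj_apply hrow p (indicatorConstLp 2 hA' hfin (1 : ℂ)),
      indicatorConstLp_coeFn (p := 2) (hs := hA') (hμs := hfin) (c := (1 : ℂ)),
      measure_eq_zero_iff_ae_notMem.1 hnull] with x h1 h2 h3
    rw [h1]
    by_cases hx : x ∈ S.range p
    · rw [Set.indicator_of_mem hx]
    · rw [Set.indicator_of_notMem hx, h2, Set.indicator_of_notMem]
      exact fun h => h3 ⟨h.1, fun h' => hx h'.2⟩)
  refine ⟨x, (Submodule.ne_bot_iff _).2 ⟨_, hx, ?_⟩⟩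
  intro h
  have := norm_indicatorConstLp (μ := μ) (c := (1 : ℂ)) (hs := hA') (hμs := hfin)
    two_ne_zero ENNReal.ofNat_ne_top
  rw [h, norm_zero, norm_one, one_mul] at this
  have h2 : 0 < μ.real (A ∩ S.range p0) := ENNReal.toReal_pos hp0.ne' hfin
  exact (Real.rpow_pos_of_pos h2 _).ne this

/-- If `t p` vanished, so would the projection of its source vertex, which fixes the indicator of a
domain of positive finite measure. -/
theorem KGraph.SBFS.Induces.apply_ne_zero (hrow : G.RowFinite) (hπ : S.Induces π) (p : Path Λ) :
    π (G.gen p) ≠ 0 := by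
  intro h
  have h1 := (KGraph.isCKFamily_map hrow π).star_mul_self p
  rw [h, mul_zero] at h1
  have hs := S.semibranching (G.degree (Path.vertex p.s))
  have hD := S.measurableSet_dom (Path.vertex p.s)
  have hlt : μ (S.dom (Path.vertex p.s)) ≠ ∞ := (hs.dom_lt_top ⟨Path.vertex p.s, rfl⟩).ne
  have h2 := hπ.apply_vertex p.s (indicatorConstLp 2 hD hlt (1 : ℂ))
  rw [← h1] at h2
  refine (hs.dom_pos ⟨Path.vertex p.s, rfl⟩).ne' (measure_eq_zero_iff_ae_notMem.2 ?_)
  filter_upwards [h2, indicatorConstLp_coeFn (p := 2) (hs := hD) (hμs := hlt) (c := (1 : ℂ)),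
    Lp.coeFn_zero ℂ 2 μ] with x h2 h3 h4 hx
  rw [Set.indicator_of_mem hx, h3, Set.indicator_of_mem hx] at h2
  rw [zero_apply, h4] at h2
  exact zero_ne_one h2

/-! ### Nonnegative functions -/

/-- Functions in `L²` whose values are nonnegative real numbers almost everywhere. -/
def IsNonneg {X : Type*} [MeasurableSpace X] {μ : Measure X} (f : Lp ℂ 2 μ) : Prop :=
  ∀ᵐ x ∂μ, ∃ r : ℝ, 0 ≤ r ∧ f x = r

theorem KGraph.SBFS.Induces.isNonneg_apply (hπ : S.Induces π) (p : Path Λ) {f : Lp ℂ 2 μ}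
    (hf : IsNonneg f) : IsNonneg (π (G.gen p) f) := by
  filter_upwards [hπ p f, S.ae_coding p hf] with x h1 h2
  by_cases hx : x ∈ S.range p
  · obtain ⟨r, hr, hr'⟩ := h2 hx
    refine ⟨(S.Φ p (S.coding (G.degree p) x)).toReal ^ (-(1 / 2) : ℝ) * r,
      mul_nonneg (Real.rpow_nonneg ENNReal.toReal_nonneg _) hr, ?_⟩
    rw [h1, Set.indicator_of_mem hx, hr', Complex.ofReal_mul]
  · exact ⟨0, le_rfl, by rw [h1, Set.indicator_of_notMem hx, Complex.ofReal_zero]⟩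

theorem IsNonneg.exists_inner_eq {X : Type*} [MeasurableSpace X] {μ : Measure X} {f g : Lp ℂ 2 μ}
    (hf : IsNonneg f) (hg : IsNonneg g) : ∃ r : ℝ, 0 ≤ r ∧ inner ℂ f g = r := by
  refine ⟨∫ x, (inner ℂ (f x) (g x)).re ∂μ, integral_nonneg_of_ae ?_, ?_⟩
  · filter_upwards [hf, hg] with x ⟨r, hr, h1⟩ ⟨s, hs, h2⟩
    simpa [h1, h2] using mul_nonneg hs hr
  · rw [L2.inner_def]
    refine Eq.trans (integral_congr_ae ?_) integral_complex_ofReal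
    filter_upwards [hf, hg] with x ⟨r, hr, h1⟩ ⟨s, hs, h2⟩
    simp [h1, h2]

/-- The nonzero spaces of vectors carried by an infinite path contain nonnegative unit vectors. -/
theorem KGraph.SBFS.Induces.exists_isNonneg (hrow : G.RowFinite) (hπ : S.Induces π)
    {x : G.InfPath} (hx : x ∈ G.support fun p => π (G.gen p)) :
    ∃ e ∈ G.fiber (fun p => π (G.gen p)) x, ‖e‖ = 1 ∧ IsNonneg e := by
  obtain ⟨ξ, hξ, h0⟩ := (Submodule.ne_bot_iff _).1 hx
  have hξ' : ((‖ξ‖⁻¹ : ℝ) : ℂ) • ξ ∈ G.fiber (fun p => π (G.gen p)) x :=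
    Submodule.smul_mem _ _ hξ
  set η := ((‖ξ‖⁻¹ : ℝ) : ℂ) • ξ with hη
  have hη1 : ‖η‖ = 1 := by
    rw [hη, norm_smul, Complex.norm_real, norm_inv, norm_norm,
      inv_mul_cancel₀ (norm_ne_zero_iff.2 h0)]
  -- The absolute value of `η` stays in the fiber: membership only says that the function vanishes
  -- off the range sets of the segments of `x`.
  have hm : MemLp (fun x => ((‖η x‖ : ℝ) : ℂ)) 2 μ := (Lp.memLp η).norm.ofReal
  refine ⟨hm.toLp, fun n => Lp.ext ?_, ?_, ?_⟩
  · filter_upwards [hπ.proj_apply hrow (x.segment 0 n zero_le) hm.toLp,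
      hπ.proj_apply hrow (x.segment 0 n zero_le) η, hm.coeFn_toLp] with y h1 h2 h3
    rw [h1]
    by_cases hy : y ∈ S.range (x.segment 0 n zero_le)
    · rw [Set.indicator_of_mem hy]
    · rw [Set.indicator_of_notMem hy, h3]
      have := hξ' n
      dsimp only at this
      rw [this, Set.indicator_of_notMem hy] at h2
      simp [h2]
  · rw [← hη1, Lp.norm_def, Lp.norm_def, eLpNorm_congr_ae hm.coeFn_toLp]
    congr 1
    exact eLpNorm_congr_norm_ae (Filter.Eventually.of_forall fun x => by simp)
  · filter_upwards [hm.coeFn_toLp] with y hy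
    exact ⟨_, norm_nonneg _, hy⟩

/-- Nonnegative unit vectors are carried to each other by the operators of the representation. -/
theorem KGraph.SBFS.Induces.apply_eq_of_isNonneg (hrow : G.RowFinite) (hπ : S.Induces π)
    (hirr : IsIrreducible π) {p : Path Λ} {x : G.InfPath}
    (hx : x ∈ G.cylinder (Path.vertex p.s)) {e e' : Lp ℂ 2 μ}
    (he : e ∈ G.fiber (fun p => π (G.gen p)) x) (he1 : ‖e‖ = 1) (hepos : IsNonneg e)
    (he' : e' ∈ G.fiber (fun p => π (G.gen p)) (G.prepend p x)) (he1' : ‖e'‖ = 1)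
    (hepos' : IsNonneg e') : π (G.gen p) e = e' := by
  have ht := hπ.isOrthogonalFamily hrow
  have h0 : e' ≠ 0 := norm_ne_zero_iff.1 (by rw [he1']; exact one_ne_zero)
  obtain ⟨c, hc⟩ := Submodule.mem_span_singleton.1
    (ht.fiber_le_span hirr.isIrreducibleFamily he' h0 (ht.apply_mem hx he))
  -- The scalar is `⟨e', t p e⟩`, which is nonnegative; it has modulus 1 because `t p` is isometric
  -- on the fiber.
  obtain ⟨r, hr, hr'⟩ := hepos'.exists_inner_eq (hπ.isNonneg_apply p hepos)
  have hcr : c = r := by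
    rw [← hr', ← hc, inner_smul_right, inner_self_eq_norm_sq_to_K, he1']
    simp
  have hnorm := ht.norm_apply hx he
  rw [← hc, norm_smul, he1, he1', mul_one, hcr, Complex.norm_real, Real.norm_of_nonneg hr] at hnorm
  rw [← hc, hcr, hnorm, Complex.ofReal_one, one_smul]

end SBFS

/-! ### Purely atomic measures -/

/-- The measure that gives each point `x` the weight `m x`. -/
def atomicMeasure {α : Type*} [MeasurableSpace α] (m : α → ℝ≥0∞) : Measure α :=
  Measure.sum fun x => m x • Measure.dirac x

section AtomicMeasure

variable {α : Type*} [MeasurableSpace α] (m : α → ℝ≥0∞)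

theorem atomicMeasure_apply {B : Set α} (hB : MeasurableSet B) :
    atomicMeasure m B = ∑' x : B, m x := by
  rw [atomicMeasure, Measure.sum_apply _ hB, tsum_subtype]
  refine tsum_congr fun x => ?_
  rw [Measure.smul_apply, Measure.dirac_apply' _ hB, smul_eq_mul]
  by_cases hx : x ∈ B <;> simp [hx]

variable [MeasurableSingletonClass α]

theorem atomicMeasure_singleton (x : α) : atomicMeasure m {x} = m x := by
  rw [atomicMeasure_apply m (measurableSet_singleton x), tsum_singleton]

theorem setLIntegral_atomicMeasure {B : Set α} (hB : MeasurableSet B) (f : α → ℝ≥0∞) :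
    ∫⁻ x in B, f x ∂atomicMeasure m = ∑' x : B, m x * f x := by
  rw [← lintegral_indicator hB, atomicMeasure, lintegral_sum_measure,
    tsum_subtype B fun x => m x * f x]
  refine tsum_congr fun x => ?_
  rw [lintegral_smul_measure, lintegral_dirac, smul_eq_mul]
  by_cases hx : x ∈ B <;> simp [hx]

/-- Countability of the support makes the set of massless points measurable, hence null. Values of
`L²` classes at charged points are thus well defined. -/
theorem ae_atomicMeasure_iff (hm : (Function.support m).Countable) {P : α → Prop} :
    (∀ᵐ x ∂atomicMeasure m, P x) ↔ ∀ x, m x ≠ 0 → P x := by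
  constructor
  · intro h x hx
    by_contra hP
    refine hx ?_
    rw [← atomicMeasure_singleton m x]
    exact measure_mono_null (Set.singleton_subset_iff.2 hP) h
  · intro h
    have h0 : atomicMeasure m (Function.support m)ᶜ = 0 := by
      rw [atomicMeasure_apply m hm.measurableSet.compl, ENNReal.tsum_eq_zero]
      exact fun x => Function.notMem_support.1 x.2
    refine measure_mono_null (fun x hx => ?_) h0
    exact fun hx' => hx (h x hx')

theorem measurable_of_countable_support {f : α → ℝ≥0∞} (hf : (Function.support f).Countable) :
    Measurable f :=
  (measurable_const (a := (0 : ℝ≥0∞))).measurable_of_countable_ne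
    (hf.mono fun _ hx => Ne.symm hx)

/-- The inner product with a normalized point mass. -/
theorem inner_indicator_singleton {x : α} {a : ℝ} (ha : 0 < a) (hm : m x = ENNReal.ofReal (a ^ 2))
    (hx : atomicMeasure m {x} ≠ ∞) (g : Lp ℂ 2 (atomicMeasure m)) :
    inner ℂ (indicatorConstLp 2 (measurableSet_singleton x) hx ((a⁻¹ : ℝ) : ℂ)) g =
      (a : ℂ) * g x := by
  rw [L2.inner_indicatorConstLp_eq_setIntegral_inner, integral_singleton, measureReal_def,
    atomicMeasure_singleton, hm, ENNReal.toReal_ofReal (by positivity)]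
  have : (a : ℂ) ≠ 0 := Complex.ofReal_ne_zero.2 ha.ne'
  simp only [RCLike.inner_apply, Complex.conj_ofReal, Complex.real_smul]
  push_cast
  field_simp

/-- The normalized point masses form an orthonormal basis. -/
theorem exists_hilbertBasis_atomicMeasure {Y : Set α} (hY : Y.Countable) (a : Y → ℝ)
    (ha : ∀ y, 0 < a y) (hm : ∀ y : Y, m y = ENNReal.ofReal (a y ^ 2)) (hm0 : ∀ x ∉ Y, m x = 0) :
    ∃ b : HilbertBasis Y ℂ (Lp ℂ 2 (atomicMeasure m)),
      ∀ y g, inner ℂ (b y) g = (a y : ℂ) * g y := by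
  classical
  have hfin : ∀ y : Y, atomicMeasure m {y.1} ≠ ∞ := fun y => by
    rw [atomicMeasure_singleton, hm]; exact ENNReal.ofReal_ne_top
  have hne : ∀ y : Y, m y ≠ 0 := fun y => by
    rw [hm]; exact (ENNReal.ofReal_pos.2 (pow_pos (ha y) 2)).ne'
  have hsupp : (Function.support m).Countable := hY.mono fun x hx => by
    by_contra h; exact hx (hm0 x h)
  let f : Y → Lp ℂ 2 (atomicMeasure m) := fun y =>
    indicatorConstLp 2 (measurableSet_singleton y.1) (hfin y) (((a y)⁻¹ : ℝ) : ℂ)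
  have hf : ∀ y g, inner ℂ (f y) g = (a y : ℂ) * g y := fun y g =>
    inner_indicator_singleton m (ha y) (hm y) (hfin y) g
  have hfval : ∀ y z : Y, f z y = if y = z then (((a y)⁻¹ : ℝ) : ℂ) else 0 := by
    intro y z
    have := (ae_atomicMeasure_iff m hsupp).1 (indicatorConstLp_coeFn (p := 2)
      (hs := measurableSet_singleton z.1) (hμs := hfin z) (c := (((a z)⁻¹ : ℝ) : ℂ))) y (hne y)
    rw [this]
    by_cases h : y = z
    · subst h; simp
    · rw [if_neg h, Set.indicator_of_notMem]
      exact fun h' => h (Subtype.ext h')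
  have horth : Orthonormal ℂ f := by
    rw [orthonormal_iff_ite]
    intro y z
    rw [hf, hfval]
    split_ifs with h
    · rw [← Complex.ofReal_mul, mul_inv_cancel₀ (ha y).ne', Complex.ofReal_one]
    · rw [mul_zero]
  refine ⟨HilbertBasis.mkOfOrthogonalEqBot horth ?_, fun y g => ?_⟩
  · rw [eq_bot_iff]
    intro g hg
    refine Lp.ext ?_
    have hz := Lp.coeFn_zero ℂ 2 (atomicMeasure m)
    refine Filter.EventuallyEq.trans ?_ hz.symm
    refine (ae_atomicMeasure_iff m hsupp).2 fun x hx => ?_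
    have hxY : x ∈ Y := by by_contra h; exact hx (hm0 x h)
    have h1 := (Submodule.mem_orthogonal _ _).1 hg (f ⟨x, hxY⟩) (Submodule.subset_span ⟨_, rfl⟩)
    rw [hf] at h1
    exact (mul_eq_zero.1 h1).resolve_left (Complex.ofReal_ne_zero.2 (ha _).ne')
  · rw [HilbertBasis.coe_mkOfOrthogonalEqBot, hf]

end AtomicMeasure

/-! ### The standard system of a purely atomic measure on the path space -/

/-- The standard maps form a semibranching function system for every finite purely atomic measure
that charges all vertices and whose atoms are preserved by the prefixing maps. -/
def KGraph.atomicSBFS (G : KGraph k Λ) (m : G.InfPath → ℝ≥0∞)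
    (hcount : (Function.support m).Countable) (hfin : atomicMeasure m Set.univ < ∞)
    (hpos : ∀ v, ∃ x ∈ G.cylinder (Path.vertex v), m x ≠ 0)
    (hinv : ∀ p, ∀ x ∈ G.cylinder (Path.vertex p.s), m (G.prepend p x) = 0 ↔ m x = 0) :
    G.SBFS G.InfPath (atomicMeasure m) where
  dom p := G.cylinder (Path.vertex p.s)
  tau := G.prepend
  coding := InfPath.shift
  -- The ratio of the masses of the points `px` and `x`. On massless points it is `0 / 0 = 0`, so it
  -- has countable support and is measurable.
  Φ p x := m (G.prepend p x) / m x
  semibranching n :=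
    { countable := by
        have : Countable (Path Λ) := G.countable
        infer_instance
      measurableSet_dom := fun p => G.measurableSet_cylinder _
      dom_pos := fun p => by
        obtain ⟨x, hx, hmx⟩ := hpos p.1.s
        refine lt_of_lt_of_le ?_ (measure_mono (Set.singleton_subset_iff.2 hx))
        rw [atomicMeasure_singleton]
        exact pos_iff_ne_zero.2 hmx
      dom_lt_top := fun p => (measure_mono (Set.subset_univ _)).trans_lt hfin
      measurable_map := fun p => G.measurable_prepend p
      measurableSet_range := fun p => by
        rw [G.prepend_image]; exact G.measurableSet_cylinder _
      range_lt_top := fun p => (measure_mono (Set.subset_univ _)).trans_lt hfin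
      range_cover := by
        have : (⋃ p : {p : Path Λ // G.degree p = n},
            G.prepend p.1 '' G.cylinder (Path.vertex p.1.s)) = Set.univ := by
          refine Set.eq_univ_of_forall fun x => Set.mem_iUnion.2
            ⟨⟨x.segment 0 n zero_le, by rw [InfPath.degree_segment, tsub_zero]⟩, ?_⟩
          rw [G.prepend_image]
          exact x.mem_cylinder_segment n
        rw [this, Set.compl_univ, measure_empty]
      range_disjoint := fun p q hpq => by
        rw [G.prepend_image, G.prepend_image]
        have : G.cylinder p.1 ∩ G.cylinder q.1 = ∅ := by
          refine Set.eq_empty_of_forall_notMem fun x hx => hpq (Subtype.ext ?_)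
          rw [← show x.segment 0 (G.degree p.1) zero_le = p.1 from hx.1,
            ← show x.segment 0 (G.degree q.1) zero_le = q.1 from hx.2]
          exact x.segment_congr _ rfl (p.2.trans q.2.symm)
        rw [this, measure_empty]
      rnDeriv := fun p => by
        have hzero : ∀ x, m x = 0 → m (G.prepend p.1 x) = 0 := by
          intro x hx
          by_cases h : x ∈ G.cylinder (Path.vertex p.1.s)
          · exact (hinv p.1 x h).2 hx
          · rwa [prepend, dif_neg h]
        refine ⟨measurable_of_countable_support
          (hcount.mono (Function.support_subset_iff'.2 fun x hx => ?_)), ?_⟩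
        · rw [hzero x (Function.notMem_support.1 hx), ENNReal.zero_div]
        · intro E hE hED
          have hinj := (G.prepend_injOn p.1).mono hED
          have himage : MeasurableSet (G.prepend p.1 '' E) := by
            have : G.prepend p.1 '' E =
                G.cylinder p.1 ∩ InfPath.shift (G.degree p.1) ⁻¹' E := by
              ext x
              constructor
              · rintro ⟨y, hy, rfl⟩
                exact ⟨G.prepend_mem (hED hy), by
                  rw [Set.mem_preimage, G.shift_prepend (hED hy)]; exact hy⟩
              · rintro ⟨h1, h2⟩
                exact ⟨_, h2, G.prepend_shift h1⟩
            rw [this]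
            exact (G.measurableSet_cylinder _).inter (G.measurable_shift _ hE)
          rw [atomicMeasure_apply m himage, setLIntegral_atomicMeasure m hE,
            tsum_image m hinj]
          refine tsum_congr fun x => ?_
          by_cases hx : m x = 0
          · rw [hzero _ hx, hx, zero_mul]
          · refine (ENNReal.mul_div_cancel hx ?_).symm
            rw [← atomicMeasure_singleton m x.1]
            exact ((measure_mono (Set.subset_univ _)).trans_lt hfin).ne
      rnDeriv_pos := fun p => by
        refine (ae_atomicMeasure_iff m hcount).2 fun x hx hxd => ENNReal.div_pos ?_ ?_
        · exact fun h => hx ((hinv p.1 x hxd).1 h)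
        · rw [← atomicMeasure_singleton m x]
          exact ((measure_mono (Set.subset_univ _)).trans_lt hfin).ne }
  coding_map n := ⟨G.measurable_shift n, by
    rintro ⟨p, rfl⟩ x hx
    exact G.shift_prepend hx⟩
  tau_vertex v x hx := G.prepend_vertex hx
  range_subset {a b c} g f := by
    have : G.prepend ⟨a, b, g⟩ '' G.cylinder (Path.vertex a) ⊆ G.cylinder (Path.vertex b) := by
      rintro _ ⟨x, hx, rfl⟩
      exact InfPath.mem_cylinder_vertex.2
        (InfPath.range_of_mem_cylinder (G.prepend_mem (p := ⟨a, b, g⟩) hx))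
    exact (congrArg _ (Set.sdiff_eq_empty.2 this)).trans measure_empty
  dom_comp g f := Filter.EventuallyEq.rfl
  tau_comp g f := Filter.Eventually.of_forall fun x hx => G.prepend_comp g f hx
  coding_comp m n := funext fun x => InfPath.shift_shift x m n

/-! ### Equivalence with a representation on the path space -/

/-- The weights of the measure on the path space that belongs to the vector `ξ`. -/
def KGraph.vectorWeight {G : KGraph k Λ} {Y : Set G.InfPath} {H : Type*} [NormedAddCommGroup H]
    [InnerProductSpace ℂ H] (b : HilbertBasis Y ℂ H) (ξ : H) (x : G.InfPath) : ℝ≥0∞ :=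
  open Classical in
  if h : x ∈ Y then ENNReal.ofReal (‖inner ℂ (b ⟨x, h⟩) ξ‖ ^ 2) else 0

theorem KGraph.vectorWeight_coe {G : KGraph k Λ} {Y : Set G.InfPath} {H : Type*} [NormedAddCommGroup H]
    [InnerProductSpace ℂ H] (b : HilbertBasis Y ℂ H) (ξ : H) (y : Y) :
    KGraph.vectorWeight b ξ y = ENNReal.ofReal (‖inner ℂ (b y) ξ‖ ^ 2) :=
  dif_pos y.2

theorem KGraph.vectorWeight_of_notMem {G : KGraph k Λ} {Y : Set G.InfPath} {H : Type*} [NormedAddCommGroup H]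
    [InnerProductSpace ℂ H] (b : HilbertBasis Y ℂ H) (ξ : H)
    {x : G.InfPath} (hx : x ∉ Y) : KGraph.vectorWeight b ξ x = 0 :=
  dif_neg hx

section

variable {G : KGraph k Λ} {H : Type*} [NormedAddCommGroup H] [InnerProductSpace ℂ H]
  [CompleteSpace H] {t : Path Λ → (H →L[ℂ] H)}

/-- Parseval's identity: the basis diagonalizes `t p * star (t p)`, so the inner product is the sum
of `|⟨b y, ξ⟩|²` over the paths `y` in `Z(p)`. -/
theorem KGraph.IsOrthogonalFamily.atomicMeasure_cylinder (ht : G.IsOrthogonalFamily t)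
    (b : HilbertBasis (G.support t) ℂ H) (hb : ∀ y, b y ∈ G.fiber t y.1) (ξ : H) (p : Path Λ) :
    atomicMeasure (KGraph.vectorWeight b ξ) (G.cylinder p) =
      ENNReal.ofReal (RCLike.re (inner ℂ ξ ((t p * star (t p)) ξ))) := by
  classical
  have hterm : ∀ y : G.support t, inner ℂ ξ (b y) * inner ℂ (b y) ((t p * star (t p)) ξ) =
      ((if y.1 ∈ G.cylinder p then ‖inner ℂ (b y) ξ‖ ^ 2 else 0 : ℝ) : ℂ) := by
    intro y
    rw [ht.inner_proj (hb y)]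
    split_ifs
    · rw [← inner_conj_symm, RCLike.conj_mul]
      norm_cast
    · simp
  have hsum := b.hasSum_inner_mul_inner ξ ((t p * star (t p)) ξ)
  simp only [hterm] at hsum
  have hre := Complex.hasSum_re hsum
  simp only [Complex.ofReal_re] at hre
  rw [atomicMeasure_apply _ (G.measurableSet_cylinder p), tsum_subtype]
  change _ = ENNReal.ofReal (Complex.re _)
  rw [← hre.tsum_eq, ENNReal.ofReal_tsum_of_nonneg (fun y => by split_ifs <;> positivity)
    hre.summable, ← tsum_subtype_eq_of_support_subset (s := G.support t)]
  · refine tsum_congr fun y => ?_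
    by_cases hy : y.1 ∈ G.cylinder p
    · rw [Set.indicator_of_mem hy, if_pos hy, KGraph.vectorWeight_coe]
    · rw [Set.indicator_of_notMem hy, if_neg hy, ENNReal.ofReal_zero]
  · refine Function.support_subset_iff'.2 fun x hx => ?_
    rw [Set.indicator_apply, KGraph.vectorWeight_of_notMem b ξ hx, ite_self]

/-- Otherwise `star (t p)` would kill every basis vector. For vertices this shows that the measure
charges every domain. -/
theorem KGraph.IsOrthogonalFamily.exists_mem_support_of_ne_zero (ht : G.IsOrthogonalFamily t)
    (b : HilbertBasis (G.support t) ℂ H) (hb : ∀ y, b y ∈ G.fiber t y.1) {p : Path Λ}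
    (hp : t p ≠ 0) : ∃ x ∈ G.cylinder p, x ∈ G.support t := by
  by_contra! h
  refine hp (ContinuousLinearMap.ext fun η => inner_self_eq_zero (𝕜 := ℂ).1 ?_)
  rw [← b.tsum_inner_mul_inner]
  refine Eq.trans (tsum_congr fun y => ?_) tsum_zero
  rw [← ContinuousLinearMap.adjoint_inner_left _ η (b y), ← ContinuousLinearMap.star_eq_adjoint,
    ht.star_eq_zero_of_notMem (fun hy => h y.1 hy y.2) (hb y), inner_zero_left, mul_zero]

theorem KGraph.IsOrthogonalFamily.atomicMeasure_univ_lt_top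
    (b : HilbertBasis (G.support t) ℂ H) (ξ : H) :
    atomicMeasure (KGraph.vectorWeight b ξ) Set.univ < ∞ := by
  have hs := (b.summable_inner_mul_inner ξ ξ).norm
  have hterm : ∀ y, ‖inner ℂ ξ (b y) * inner ℂ (b y) ξ‖ = ‖inner ℂ (b y) ξ‖ ^ 2 := by
    intro y
    rw [norm_mul, norm_inner_symm, sq]
  simp only [hterm] at hs
  rw [atomicMeasure_apply _ MeasurableSet.univ, tsum_univ (KGraph.vectorWeight b ξ),
    ← tsum_subtype_eq_of_support_subset (s := G.support t)
      (Function.support_subset_iff'.2 fun x hx => KGraph.vectorWeight_of_notMem b ξ hx)]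
  simp only [KGraph.vectorWeight_coe]
  rw [← ENNReal.ofReal_tsum_of_nonneg (fun y => sq_nonneg _) hs]
  exact ENNReal.ofReal_lt_top

end

/-- A representation on `L²(Λ^∞, ν)` for a purely atomic measure `ν` arises from the standard
system if its generators act in the expected way on normalized point masses. -/
theorem KGraph.induces_atomicSBFS {G : KGraph k Λ} {m : G.InfPath → ℝ≥0∞}
    (hcount : (Function.support m).Countable) (hfin : atomicMeasure m Set.univ < ∞)
    (hpos : ∀ v, ∃ x ∈ G.cylinder (Path.vertex v), m x ≠ 0)
    (hinv : ∀ p, ∀ x ∈ G.cylinder (Path.vertex p.s), m (G.prepend p x) = 0 ↔ m x = 0)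
    {Y : Set G.InfPath} {a : Y → ℝ} (ha : ∀ y, 0 < a y)
    (hm : ∀ y : Y, m y = ENNReal.ofReal (a y ^ 2)) (hm0 : ∀ x ∉ Y, m x = 0)
    {ρ : KGraph.CStar.{u} G →⋆ₙₐ[ℂ]
      (Lp ℂ 2 (atomicMeasure m) →L[ℂ] Lp ℂ 2 (atomicMeasure m))}
    (hin : ∀ p (y z : Y), y.1 ∈ G.cylinder p → z.1 = y.1.shift (G.degree p) →
      ∀ g, (a y : ℂ) * ρ (G.gen p) g y = (a z : ℂ) * g z)
    (hout : ∀ p (y : Y), y.1 ∉ G.cylinder p → ∀ g, ρ (G.gen p) g y = 0) :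
    (G.atomicSBFS m hcount hfin hpos hinv).Induces ρ := by
  intro p g
  have hrange : (G.atomicSBFS m hcount hfin hpos hinv).range p = G.cylinder p :=
    G.prepend_image p
  refine (ae_atomicMeasure_iff m hcount).2 fun x hx => ?_
  rw [hrange]
  have hxY : x ∈ Y := by by_contra h; exact hx (hm0 x h)
  by_cases hxp : x ∈ G.cylinder p
  · rw [Set.indicator_of_mem hxp]
    have hz : x.shift (G.degree p) ∈ Y := by
      by_contra h
      refine hx ?_
      rw [← G.prepend_shift hxp]
      exact (hinv p _ (InfPath.shift_mem_cylinder hxp)).2 (hm0 _ h)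
    have h1 := hin p ⟨x, hxY⟩ ⟨_, hz⟩ hxp rfl g
    have ha1 := ha ⟨x, hxY⟩
    have ha2 := ha ⟨_, hz⟩
    change ρ (G.gen p) g x = (((m (G.prepend p (x.shift (G.degree p))) /
      m (x.shift (G.degree p))).toReal ^ (-(1 / 2) : ℝ) : ℝ) : ℂ) * g (x.shift (G.degree p))
    -- The derivative is `(a_x / a_z)²` with `z` the shifted path, and its power `-1/2` is the
    -- factor `a_z / a_x` given by `hin`.
    rw [G.prepend_shift hxp, hm ⟨x, hxY⟩, hm ⟨_, hz⟩, ENNReal.toReal_div,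
      ENNReal.toReal_ofReal (by positivity), ENNReal.toReal_ofReal (by positivity),
      Real.rpow_neg (by positivity), ← Real.sqrt_eq_rpow, ← div_pow, Real.sqrt_sq (by positivity)]
    have hne : (a ⟨x, hxY⟩ : ℂ) ≠ 0 := Complex.ofReal_ne_zero.2 ha1.ne'
    refine mul_left_cancel₀ hne (h1.trans ?_)
    push_cast
    field_simp
  · rw [Set.indicator_of_notMem hxp]
    exact hout p ⟨x, hxY⟩ hxp g

/-! ### Monic vectors and the unitary equivalence -/

section

variable {G : KGraph k Λ} {X : Type u} [MeasurableSpace X] {μ : Measure X} {S : G.SBFS X μ}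
  {π : KGraph.CStar.{u} G →⋆ₙₐ[ℂ] (Lp ℂ 2 μ →L[ℂ] Lp ℂ 2 μ)}

/-- If nonzero vectors are carried by infinite paths, then there is an orthonormal basis of such
vectors that the adjoints of the generators permute. -/
theorem KGraph.SBFS.Induces.exists_hilbertBasis (hrow : G.RowFinite) (hπ : S.Induces π)
    (hirr : IsIrreducible π) (hne : (G.support fun p => π (G.gen p)).Nonempty) :
    ∃ b : HilbertBasis (G.support fun p => π (G.gen p)) ℂ (Lp ℂ 2 μ),
      (∀ y, b y ∈ G.fiber (fun p => π (G.gen p)) y.1) ∧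
      ∀ p (y z : G.support fun p => π (G.gen p)), y.1 ∈ G.cylinder p →
        z.1 = y.1.shift (G.degree p) → star (π (G.gen p)) (b y) = b z := by
  have ht := hπ.isOrthogonalFamily hrow
  have hex : ∀ y : G.support fun p => π (G.gen p), ∃ e ∈ G.fiber (fun p => π (G.gen p)) y.1,
    ‖e‖ = 1 ∧ IsNonneg e := fun y => hπ.exists_isNonneg hrow y.2
  choose e he he1 hepos using hex
  obtain ⟨b, rfl⟩ := ht.exists_hilbertBasis hirr.isIrreducibleFamily hne e he he1
  refine ⟨b, he, fun p y z hy hz => ?_⟩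
  have hzs : z.1 ∈ G.cylinder (Path.vertex p.s) := hz ▸ InfPath.shift_mem_cylinder hy
  have hyz : G.prepend p z.1 = y.1 := by rw [hz, G.prepend_shift hy]
  have h1 : π (G.gen p) (b z) = b y := hπ.apply_eq_of_isNonneg hrow hirr hzs (he z) (he1 z)
    (hepos z) (by rw [hyz]; exact he y) (he1 y) (hepos y)
  have h2 := ht.vertex_of_mem (he z)
  rw [InfPath.mem_cylinder_vertex.1 hzs] at h2
  rw [← h1]
  exact (ht.star_apply_self p (b z)).trans h2

theorem KGraph.SBFS.Induces.isMonic (hrow : G.RowFinite) (hπ : S.Induces π)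
    (hirr : IsIrreducible π) (hne : (G.support fun p => π (G.gen p)).Nonempty) :
    G.IsMonic π := by
  obtain ⟨b, hb, -⟩ := hπ.exists_hilbertBasis hrow hirr hne
  exact ⟨hπ.apply_ne_zero hrow,
    (hπ.isOrthogonalFamily hrow).exists_cyclic hirr.isIrreducibleFamily b hb⟩

/-- The unitary matches the basis of nonnegative fiber vectors with normalized point masses, and `ρ`
is the conjugate of `π`. It sends `ξ` to a function of modulus 1, not necessarily to the constant 1;
this suffices because the measure involves only the moduli of the coordinates of `ξ`. -/
theorem KGraph.SBFS.Induces.exists_standard (hrow : G.RowFinite) (hπ : S.Induces π)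
    (hirr : IsIrreducible π) (hne : (G.support fun p => π (G.gen p)).Nonempty) {ξ : Lp ℂ 2 μ}
    (hξ : G.IsMonicVector π ξ) :
    ∃ ν : Measure G.InfPath,
      (∀ p, ν (G.cylinder p) =
        ENNReal.ofReal (RCLike.re (inner ℂ ξ (π (G.gen p * star (G.gen p)) ξ)))) ∧
      ∃ (T : G.SBFS G.InfPath ν)
        (ρ : KGraph.CStar.{u} G →⋆ₙₐ[ℂ] (Lp ℂ 2 ν →L[ℂ] Lp ℂ 2 ν))
        (U : Lp ℂ 2 μ ≃ₗᵢ[ℂ] Lp ℂ 2 ν),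
        T.IsStandard ∧ T.Induces ρ ∧ ∀ a η, U (π a η) = ρ a (U η) := by
  have ht := hπ.isOrthogonalFamily hrow
  obtain ⟨b, hb, hstar⟩ := hπ.exists_hilbertBasis hrow hirr hne
  let Y := G.support fun p => π (G.gen p)
  have hYc : Y.Countable := ht.countable_support hirr.isIrreducibleFamily
  set m := KGraph.vectorWeight b ξ
  let a : Y → ℝ := fun y => ‖inner ℂ (b y) ξ‖
  have ha : ∀ y, 0 < a y := fun y => norm_pos_iff.2 (ht.inner_ne_zero (hb y)
    (norm_ne_zero_iff.1 (by rw [b.orthonormal.1 y]; exact one_ne_zero)) hξ)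
  have hm : ∀ y : Y, m y = ENNReal.ofReal (a y ^ 2) := fun y => KGraph.vectorWeight_coe b ξ y
  have hm0 : ∀ x ∉ Y, m x = 0 := fun x hx => KGraph.vectorWeight_of_notMem b ξ hx
  have hm_iff : ∀ x, m x = 0 ↔ x ∉ Y := fun x =>
    ⟨fun h hx => (ENNReal.ofReal_pos.2 (pow_pos (ha ⟨x, hx⟩) 2)).ne' ((hm ⟨x, hx⟩).symm.trans h),
      hm0 x⟩
  have hcount : (Function.support m).Countable := hYc.mono fun x hx => by
    by_contra h; exact hx (hm0 x h)
  have hfin : atomicMeasure m Set.univ < ∞ :=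
    KGraph.IsOrthogonalFamily.atomicMeasure_univ_lt_top b ξ
  have hinv : ∀ p, ∀ x ∈ G.cylinder (Path.vertex p.s), m (G.prepend p x) = 0 ↔ m x = 0 :=
    fun p x hx => by rw [hm_iff, hm_iff, ht.prepend_mem_support hx]
  have hpos : ∀ v, ∃ x ∈ G.cylinder (Path.vertex v), m x ≠ 0 := by
    intro v
    obtain ⟨x, hx, hxY⟩ := ht.exists_mem_support_of_ne_zero b hb
      (hπ.apply_ne_zero hrow (Path.vertex v))
    exact ⟨x, hx, fun h => (hm_iff x).1 h hxY⟩
  obtain ⟨b', hb'⟩ := exists_hilbertBasis_atomicMeasure m hYc a ha hm hm0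
  let U : Lp ℂ 2 μ ≃ₗᵢ[ℂ] Lp ℂ 2 (atomicMeasure m) := b.repr.trans b'.repr.symm
  have hU : ∀ y η, inner ℂ (b' y) (U η) = inner ℂ (b y) η := by
    intro y η
    rw [← b'.repr_apply_apply, ← b.repr_apply_apply]
    simp [U]
  let ρ : KGraph.CStar.{u} G →⋆ₙₐ[ℂ]
      (Lp ℂ 2 (atomicMeasure m) →L[ℂ] Lp ℂ 2 (atomicMeasure m)) :=
    NonUnitalStarAlgHom.comp (U.conjStarAlgEquiv : _ →⋆ₙₐ[ℂ] _) π
  have hρ : ∀ c g, ρ c g = U (π c (U.symm g)) := fun _ _ => rfl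
  -- Values at `y` are coefficients against basis vectors, and `star (t p)` sends the basis vector
  -- of `y` to that of the shifted path or to zero.
  have hcoord : ∀ p (y : Y) g, (a y : ℂ) * ρ (G.gen p) g y =
      inner ℂ (star (π (G.gen p)) (b y)) (U.symm g) := by
    intro p y g
    rw [← hb', hρ, hU, ContinuousLinearMap.star_eq_adjoint,
      ContinuousLinearMap.adjoint_inner_left]
  refine ⟨atomicMeasure m, fun p => ?_, G.atomicSBFS m hcount hfin hpos hinv, ρ, U,
    ⟨fun p => rfl, fun p x hx => ⟨G.prepend_mem hx, G.shift_prepend hx⟩, fun n => rfl⟩,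
    KGraph.induces_atomicSBFS hcount hfin hpos hinv ha hm hm0 ?_ ?_, fun c η => ?_⟩
  · rw [map_mul, map_star]
    exact ht.atomicMeasure_cylinder b hb ξ p
  · intro p y z hy hz g
    rw [hcoord, hstar p y z hy hz, ← hb' z g, ← hU, LinearIsometryEquiv.apply_symm_apply]
  · intro p y hy g
    have h1 := hcoord p y g
    rw [show star (π (G.gen p)) (b y) = 0 from ht.star_eq_zero_of_notMem hy (hb y),
      inner_zero_left] at h1
    exact (mul_eq_zero.1 h1).resolve_left (Complex.ofReal_ne_zero.2 (ha y).ne')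
  · rw [hρ, LinearIsometryEquiv.symm_apply_apply]

end

end HigherRank

end

theorem mainTheorem7 {k : ℕ} {Λ : Type w} [SmallCategory Λ] (G : HigherRank.KGraph k Λ)
    (hrow : G.RowFinite) (hsource : G.SourceFree)
    {X : Type u} [MeasurableSpace X] (μ : Measure X) (hatom : HigherRank.HasAtom μ)
    (S : G.SBFS X μ)
    (π : HigherRank.KGraph.CStar.{u} G →⋆ₙₐ[ℂ] (Lp ℂ 2 μ →L[ℂ] Lp ℂ 2 μ))
    (hπ : S.Induces π) (hirr : HigherRank.IsIrreducible π) :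
    G.IsMonic π ∧
    ∀ ξ : Lp ℂ 2 μ, G.IsMonicVector π ξ →
      ∃ ν : Measure G.InfPath,
        (∀ p, ν (G.cylinder p) =
          ENNReal.ofReal (RCLike.re (inner ℂ ξ (π (G.gen p * star (G.gen p)) ξ)))) ∧
        ∃ (T : G.SBFS G.InfPath ν)
          (ρ : HigherRank.KGraph.CStar.{u} G →⋆ₙₐ[ℂ] (Lp ℂ 2 ν →L[ℂ] Lp ℂ 2 ν))
          (U : Lp ℂ 2 μ ≃ₗᵢ[ℂ] Lp ℂ 2 ν),
          T.IsStandard ∧ T.Induces ρ ∧ ∀ a η, U (π a η) = ρ a (U η) := by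
  have hne := hπ.support_nonempty hrow hatom
  exact ⟨hπ.isMonic hrow hirr hne, fun ξ hξ => hπ.exists_standard hrow hirr hne hξ⟩
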